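/- Let $(X,d)$ be a metric space, let $\phi:X\to(-\infty,+\infty]$ be proper and lower semicontinuous with domain $\mathrm{Dom}(\phi)=\{\phi<+\infty\}$, and let $\lambda\in\mathbb R$. *Definitions.* The metric derivative of a curve $v$ is $|\dot v|(t)=\lim_{h\to0}d(v_{t+h},v_t)/|h|$, where the limit exists. The curve $v$ belongs to $AC^2_{loc}([0,\infty);X)$ if for every compact interval $[a,b]\subset[0,\infty)$ there is $m\in L^2(a,b)$ with $d(v_s,v_t)\le\int_s^t m(r)\,dr$ for all $a\le s\le t\le b$; then $|\dot v|(t)$ exists for a.e. $t>0$. The metric slope is $|\partial\phi|(x)=\limsup_{y\to x}(\phi(x)-\phi(y))^+/d(x,y)$ for $x\in\mathrm{Dom}(\phi)$ (and $0$ if $x$ is isolated), and $|\partial\phi|(x)=+\infty$ for $x\notin\mathrm{Dom}(\phi)$. A curve $v\in AC^2_{loc}([0,\infty);X)$ satisfies (EDI$_0$) if $v_0\in\mathrm{Dom}(\phi)$ and $$\int_0^t\Big(\tfrac12|\dot v|^2(r)+\tfrac12|\partial\phi|^2(v_r)\Big)dr+\phi(v_t)\le\phi(v_0)\qquad\text{for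 every }t>0.$$ It is a curve of maximal slope if $t\mapsto\phi(v_t)$ is finite and locally absolutely continuous on $[0,\infty)$ and $\frac{d}{dt}\phi(v_t)\le-\frac12|\dot v|^2(t)-\frac12|\partial\phi|^2(v_t)$ for a.e. $t>0$. A solution of EVI$_\lambda$ is a continuous curve $u:(0,\infty)\to\mathrm{Dom}(\phi)$ such that $$\tfrac12\tfrac{d}{dt}^{+}d^2(u_t,w)+\tfrac\lambda2d^2(u_t,w)\le\phi(w)-\phi(u_t)\qquad\text{for every }t>0,\ w\in\mathrm{Dom}(\phi),$$ where $\frac{d}{dt}^{+}$ is the upper right Dini derivative. An EVI$_\lambda$-gradient flow of $\phi$ in $D\subset\overline{\mathrm{Dom}(\phi)}$ is a family of continuous maps $S_t:D\to D$, $t\ge0$, such that for every $u\in D$: $S_{t+h}u=S_hS_tu$ for all $t,h\ge0$, $\lim_{t\downarrow0}S_tu=S_0u=u$, and $t\mapsto S_tu$ is a solution of EVI$_\lambda$. **Theorem.** Assume that an EVI$_\lambda$-gradient flow $(S_t)_{t\ge0}$ of $\phi$ exists in a set $D\subset\overline{\mathrm{Dom}(\phi)}$. 1. If $v\in AC^2_{loc}([0,\infty);X)$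 satisfies (EDI$_0$) and $v_t\in D$ for all $t\ge0$, then $v_t=S_t(v_0)$ for every $t\ge0$. 2. For a curve $v:[0,\infty)\to D$ with $v_0\in\mathrm{Dom}(\phi)$ the following are equivalent: $v$ is a curve of maximal slope; $v\in AC^2_{loc}([0,\infty);X)$ and $v$ satisfies (EDI$_0$); $v$ is continuous on $[0,\infty)$ and its restriction to $(0,\infty)$ is a solution of EVI$_\lambda$. 3. Two curves in $AC^2_{loc}([0,\infty);X)$ with values in $D$ that satisfy (EDI$_0$) and have the same initial point coincide. -/

import Mathlib

open scoped ENNReal Topology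
open MeasureTheory Set Filter

noncomputable section

namespace MetricFlow

variable {X : Type*} [MetricSpace X]

/-- The curve `x` belongs to `AC^p(I; X)`: there is `m ∈ L^p(I)` with
`d(x_s, x_t) ≤ ∫_s^t m(r) dr` for all `s ≤ t` in the interval `I`. -/
def ACOn (p : ℝ≥0∞) (I : Set ℝ) (x : ℝ → X) : Prop :=
  ∃ m : ℝ → ℝ, MemLp m p (volume.restrict I) ∧
    ∀ s ∈ I, ∀ t ∈ I, s ≤ t → dist (x s) (x t) ≤ ∫ r in s..t, m r

/-- The curve `x` belongs to `AC^p_loc(I; X)`: it is in `AC^p` of every compact subinterval. -/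
def LocACOn (p : ℝ≥0∞) (I : Set ℝ) (x : ℝ → X) : Prop :=
  ∀ a b : ℝ, a ≤ b → Icc a b ⊆ I → ACOn p (Icc a b) x

/-- The metric derivative `|ẋ|(t) = lim_{h → 0} d(x_{t+h}, x_t) / |h|`. It is written with an upper
limit in `[0, ∞]`, which is the limit at every `t` where the limit exists (for an absolutely
continuous curve, at almost every `t`). -/
def metricDeriv (x : ℝ → X) (t : ℝ) : ℝ≥0∞ :=
  limsup (fun h : ℝ => edist (x (t + h)) (x t) / ENNReal.ofReal |h|) (𝓝[≠] 0)

/-- `φ : X → (-∞, +∞]` is proper and lower semicontinuous. -/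
structure IsProperLSC (φ : X → EReal) : Prop where
  ne_bot : ∀ x, φ x ≠ ⊥
  proper : ∃ x, φ x ≠ ⊤
  lsc : LowerSemicontinuous φ

/-- The (effective) domain of `φ`. -/
def Dom (φ : X → EReal) : Set X := {x | φ x < ⊤}

/-- The metric slope `|∂φ|(x) = limsup_{y → x} (φ(x) - φ(y))⁺ / d(x, y)` for `x` in the domain of
`φ`, and `+∞` outside the domain. `EReal.toENNReal` is the positive part. If `x` is an isolated
point then the punctured neighbourhood filter is `⊥` and the upper limit, taken in `[0, ∞]`,
is `0`. -/
def slope (φ : X → EReal) (x : X) : ℝ≥0∞ :=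
  open Classical in
  if x ∈ Dom φ then limsup (fun y => (φ x - φ y).toENNReal / edist x y) (𝓝[≠] x) else ⊤

/-- The upper right Dini derivative, with values in `[-∞, +∞]`. -/
def upperRightDini (ζ : ℝ → ℝ) (t : ℝ) : EReal :=
  limsup (fun h : ℝ => (((ζ (t + h) - ζ t) / h : ℝ) : EReal)) (𝓝[>] 0)

/-- `u` (restricted to `(0, ∞)`) solves the Evolution Variational Inequality `EVI_λ`. -/
structure IsEVISolution (φ : X → EReal) (lam : ℝ) (u : ℝ → X) : Prop where
  continuousOn : ContinuousOn u (Ioi 0)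
  mem_dom : ∀ t, 0 < t → u t ∈ Dom φ
  evi : ∀ t, 0 < t → ∀ v ∈ Dom φ,
    ((1 / 2 : ℝ) : EReal) * upperRightDini (fun s => dist (u s) v ^ 2) t
      + ((lam / 2 * dist (u t) v ^ 2 : ℝ) : EReal) ≤ φ v - φ (u t)

/-- `S` (restricted to `t ≥ 0` and to `D`) is an `EVI_λ`-gradient flow of `φ` in `D`. -/
structure IsEVIGradientFlow (φ : X → EReal) (lam : ℝ) (D : Set X) (S : ℝ → X → X) : Prop where
  subset_closure : D ⊆ closure (Dom φ)
  mapsTo : ∀ t, 0 ≤ t → MapsTo (S t) D D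
  continuousOn : ∀ t, 0 ≤ t → ContinuousOn (S t) D
  semigroup : ∀ u ∈ D, ∀ t h, 0 ≤ t → 0 ≤ h → S (t + h) u = S h (S t u)
  zero : ∀ u ∈ D, S 0 u = u
  tendsto_zero : ∀ u ∈ D, Tendsto (fun t => S t u) (𝓝[>] 0) (𝓝 u)
  evi : ∀ u ∈ D, IsEVISolution φ lam (fun t => S t u)

/-- The dissipation density `|v̇|²(r) / 2 + |∂φ|²(v_r) / 2`. -/
def dissipation (φ : X → EReal) (v : ℝ → X) (r : ℝ) : ℝ≥0∞ :=
  metricDeriv v r ^ 2 / 2 + slope φ (v r) ^ 2 / 2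

/-- A curve `v ∈ AC²_loc([0, ∞); X)` satisfies the Energy-Dissipation Inequality starting
from `t = 0`. -/
structure SatisfiesEDI (φ : X → EReal) (v : ℝ → X) : Prop where
  ac : LocACOn 2 (Ici 0) v
  mem_dom : v 0 ∈ Dom φ
  edi : ∀ t, 0 < t →
    ((∫⁻ r in Ioc 0 t, dissipation φ v r : ℝ≥0∞) : EReal) + φ (v t) ≤ φ (v 0)

/-- `v ∈ AC²_loc([0, ∞); X)` is a curve of maximal slope: `t ↦ φ(v_t)` is (finite and) locally
absolutely continuous in `[0, ∞)` and its derivative is at most minus the dissipation density at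
almost every `t > 0`. -/
structure IsCurveOfMaximalSlope (φ : X → EReal) (v : ℝ → X) : Prop where
  ac : LocACOn 2 (Ici 0) v
  mem_dom : ∀ t, 0 ≤ t → v t ∈ Dom φ
  energy_ac : ∀ T, 0 < T → AbsolutelyContinuousOnInterval (fun t => (φ (v t)).toReal) 0 T
  deriv_le : ∀ᵐ t ∂(volume.restrict (Ioi (0 : ℝ))),
    ((deriv (fun s => (φ (v s)).toReal) t : ℝ) : EReal) ≤ -((dissipation φ v t : ℝ≥0∞) : EReal)

end MetricFlow

end

/-!
Curves satisfying the energy dissipation inequality (EDI) coincide with trajectories of the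
`EVI_λ`-gradient flow, because such a curve `v` is, at almost every time `t`, tangent to the flow
trajectory issued from `v t`, and the flow is `λ`-contractive.

*From the EVI.* Testing the EVI with earlier points of the solution shows that the energy decreases
(`IsEVISolution.energy_le`), and doubling variables gives the contraction
`IsEVISolution.dist_le_exp_mul_dist`. A trajectory issued from `x` leaves `x` with a speed not
exceeding the slope (`IsEVISolution.eventually_dist_le`); inserting this in the EVI shows that the
slope controls the energy globally,
`φ x - φ y ≤ |∂φ|(x) d(x, y) - λ / 2 d(x, y)²` (`IsEVISolution.sub_le_slope_mul_dist`).

*Energy identity.* Let `v` satisfy the EDI. Averaging the global slope inequality between `v s` and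
`v (s + δ)` over `s` and letting `δ → 0` gives the inequality opposite to the EDI
(`sub_le_integral_add_of_ae_sub_le`, `SatisfiesEDI.energy_sub_eq`). No regularity of the
energy beyond lower semicontinuity is needed. Hence the energy is absolutely continuous and, at
almost every time, the metric speed equals the slope `g` and the energy has derivative `-g²`
(`SatisfiesEDI.ae_hasDerivAt`).

*Tangency.* At such a time put `x = v t` and test the EVI of `s ↦ S s x` on `[0, h]` with
`v (t + h)`. Up to `o(h²)`, half the squared distance from `x` to `v (t + h)` is at most
`g² h² / 2`, while the energy terms integrate to at most `-g² h² + g² h² / 2`. So half the squared distance from `S h x`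
to `v (t + h)` is `o(h²)` (`IsEVISolution.eventually_dist_le_mul`). Contraction then shows that
`δ t = d(v t, S t (v 0))` satisfies `δ' ≤ -λ δ` almost everywhere with `δ 0 = 0`, so `δ = 0`
(`SatisfiesEDI.eq_flow`).

*From the EVI to maximal slope.* For a solution `u` with energy `f`, the quadratic bound
`d(u s, u t)² ≤ C (t - s) (f s - f t)` and the same averaged chain rule make `f` absolutely
continuous; where `f` is differentiable, the EVI bounds both the right speed and the slope by
`√(-f')` (`IsEVISolution.isCurveOfMaximalSlope`). Integrating the differential inequality of a curve
of maximal slope gives back the EDI.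
-/

namespace MetricFlow

variable {X : Type*} [MetricSpace X] {φ : X → EReal} {lam : ℝ} {u v : ℝ → X} {D : Set X}
  {S : ℝ → X → X}

/-! ### Solutions of the evolution variational inequality: monotone energy and contraction -/

lemma IsProperLSC.coe_toReal (hφ : IsProperLSC φ) {x : X} (hx : x ∈ Dom φ) :
    ((φ x).toReal : EReal) = φ x :=
  EReal.coe_toReal (ne_of_lt hx) (hφ.ne_bot x)

lemma IsProperLSC.toReal_le_toReal (hφ : IsProperLSC φ) {x y : X} (hx : x ∈ Dom φ)
    (hy : y ∈ Dom φ) : (φ x).toReal ≤ (φ y).toReal ↔ φ x ≤ φ y := by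
  rw [← EReal.coe_le_coe_iff, hφ.coe_toReal hx, hφ.coe_toReal hy]

lemma IsProperLSC.eventually_lt_toReal (hφ : IsProperLSC φ) {x : X} (hx : x ∈ Dom φ) {c : ℝ}
    (hc : c < (φ x).toReal) : ∀ᶠ y in 𝓝 x, y ∈ Dom φ → c < (φ y).toReal := by
  have h : (c : EReal) < φ x := by rwa [← hφ.coe_toReal hx, EReal.coe_lt_coe_iff]
  filter_upwards [hφ.lsc x c h] with y hy hyD
  rw [← hφ.coe_toReal hyD] at hy
  exact EReal.coe_lt_coe_iff.1 hy

lemma tendsto_sub_nhdsGT (t : ℝ) : Tendsto (fun z => z - t) (𝓝[>] t) (𝓝[>] 0) := by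
  refine tendsto_nhdsWithin_iff.2 ⟨?_, ?_⟩
  · have : Tendsto (fun z => z - t) (𝓝 t) (𝓝 (t - t)) := Continuous.tendsto (by fun_prop) t
    rw [sub_self] at this
    exact this.mono_left nhdsWithin_le_nhds
  · filter_upwards [self_mem_nhdsWithin] with z hz
    simpa using hz

lemma tendsto_add_nhdsGT (t : ℝ) : Tendsto (fun h => t + h) (𝓝[>] 0) (𝓝[>] t) := by
  refine tendsto_nhdsWithin_iff.2 ⟨?_, ?_⟩
  · have : Tendsto (fun h : ℝ => t + h) (𝓝 0) (𝓝 (t + 0)) := Continuous.tendsto (by fun_prop) 0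
    rw [add_zero] at this
    exact this.mono_left nhdsWithin_le_nhds
  · filter_upwards [self_mem_nhdsWithin] with h hh
    simpa using hh

lemma tendsto_slope_nhdsGT {f : ℝ → ℝ} {f' t : ℝ} (hf : HasDerivAt f f' t) :
    Tendsto (_root_.slope f t) (𝓝[>] t) (𝓝 f') :=
  (hasDerivAt_iff_tendsto_slope.1 hf).mono_left (nhdsWithin_mono t fun _ hx => ne_of_gt hx)

/-- The EVI at time `t` in real-valued form. In the extended reals the Dini derivative in the EVI
might be infinite, but the value `⊤` is excluded by the finite right-hand side. -/
lemma IsEVISolution.eventually_slope_lt (hφ : IsProperLSC φ) (hu : IsEVISolution φ lam u) {t : ℝ}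
    (ht : 0 < t) {w : X} (hw : w ∈ Dom φ) {r : ℝ}
    (hr : (φ w).toReal - (φ (u t)).toReal - lam / 2 * dist (u t) w ^ 2 < r) :
    ∀ᶠ z in 𝓝[>] t, _root_.slope (fun s => dist (u s) w ^ 2 / 2) t z < r := by
  have h := hu.evi t ht w hw
  rw [← hφ.coe_toReal hw, ← hφ.coe_toReal (hu.mem_dom t ht), ← EReal.coe_sub] at h
  have hlt : upperRightDini (fun s => dist (u s) w ^ 2) t < ((2 * r : ℝ) : EReal) := by
    by_contra hcon
    have h1 : ((1 / 2 : ℝ) : EReal) * ((2 * r : ℝ) : EReal) ≤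
        ((1 / 2 : ℝ) : EReal) * upperRightDini (fun s => dist (u s) w ^ 2) t :=
      mul_le_mul_of_nonneg_left (not_lt.1 hcon) (EReal.coe_nonneg.2 (by norm_num))
    have h2 := (add_le_add_left h1 ((lam / 2 * dist (u t) w ^ 2 : ℝ) : EReal)).trans h
    rw [← EReal.coe_mul, ← EReal.coe_add, EReal.coe_le_coe_iff] at h2
    linarith
  have hev := (tendsto_sub_nhdsGT t).eventually (eventually_lt_of_limsup_lt hlt)
  filter_upwards [hev, self_mem_nhdsWithin] with z hz hzt
  rw [EReal.coe_lt_coe_iff] at hz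
  have hzt' : 0 < z - t := sub_pos.2 hzt
  rw [slope_def_field]
  rw [add_sub_cancel, div_lt_iff₀ hzt'] at hz
  rw [div_lt_iff₀ hzt']
  linarith

/-- A comparison principle for the upper right Dini derivative. Nothing is assumed at the left end
point, where an EVI need not hold. -/
lemma sub_le_sub_of_eventually_slope_lt {f B B' : ℝ → ℝ} {a b : ℝ} (hab : a ≤ b)
    (hf : ContinuousOn f (Icc a b)) (hB : ContinuousOn B (Icc a b))
    (hB' : ∀ x ∈ Ioo a b, HasDerivAt B (B' x) x)
    (h : ∀ x ∈ Ioo a b, ∀ r, B' x < r → ∀ᶠ z in 𝓝[>] x, _root_.slope f x z < r) :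
    f b - f a ≤ B b - B a := by
  rcases hab.eq_or_lt with rfl | hab
  · simp
  have key : ∀ a' ∈ Ioo a b, f b - f a' ≤ B b - B a' := by
    intro a' ha'
    have hsub : Icc a' b ⊆ Icc a b := Icc_subset_Icc_left ha'.1.le
    have hIoo : Ico a' b ⊆ Ioo a b := fun x hx => ⟨ha'.1.trans_le hx.1, hx.2⟩
    have := image_le_of_liminf_slope_right_le_deriv_boundary (f := f)
      (B := fun x => B x + (f a' - B a')) (B' := B') (hf.mono hsub)
      (by simp) ((hB.mono hsub).add continuousOn_const)
      (fun x hx => ((hB' x (hIoo hx)).add_const _).hasDerivWithinAt)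
      (fun x hx r hr => (h x (hIoo hx) r hr).frequently) (right_mem_Icc.2 ha'.2.le)
    linarith
  have ha : a ∈ Icc a b := left_mem_Icc.2 hab.le
  have hmem : Ioo a b ∈ 𝓝[>] a := Ioo_mem_nhdsGT hab
  have hmono : 𝓝[>] a ≤ 𝓝[Icc a b] a := by
    rw [← nhdsWithin_Ioo_eq_nhdsGT hab]
    exact nhdsWithin_mono _ Ioo_subset_Icc_self
  refine le_of_tendsto_of_tendsto (b := 𝓝[>] a) (f := fun x => f b - f x) (g := fun x => B b - B x)
    (((hf a ha).mono_left hmono).const_sub _) (((hB a ha).mono_left hmono).const_sub _) ?_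
  filter_upwards [hmem] with x hx using key x hx

lemma continuousOn_half_sq_dist {I : Set ℝ} (hu : ContinuousOn u I) (hv : ContinuousOn v I) :
    ContinuousOn (fun s => dist (u s) (v s) ^ 2 / 2) I :=
  fun t ht => (((hu t ht).dist (hv t ht)).pow 2).div_const 2

lemma IsEVISolution.half_sq_dist_le_gronwallBound (hφ : IsProperLSC φ)
    (hu : IsEVISolution φ lam u) {s t : ℝ} (hs : 0 < s) (hst : s ≤ t) {w : X} (hw : w ∈ Dom φ)
    {c : ℝ} (hc : ∀ r ∈ Ico s t, (φ w).toReal - (φ (u r)).toReal ≤ c) :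
    dist (u t) w ^ 2 / 2 ≤ gronwallBound (dist (u s) w ^ 2 / 2) |lam| c (t - s) := by
  have hcont : ContinuousOn (fun r => dist (u r) w ^ 2 / 2) (Icc s t) :=
    continuousOn_half_sq_dist (hu.continuousOn.mono fun r hr => hs.trans_le hr.1) continuousOn_const
  refine le_gronwallBound_of_liminf_deriv_right_le hcont
    (f' := fun r => (φ w).toReal - (φ (u r)).toReal - lam / 2 * dist (u r) w ^ 2) ?_ le_rfl ?_ t
    (right_mem_Icc.2 hst)
  · intro x hx r hr
    refine ((hu.eventually_slope_lt hφ (hs.trans_le hx.1) hw hr).mono fun z hz => ?_).frequently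
    simpa [_root_.slope, smul_eq_mul] using hz
  · intro x hx
    have := hc x hx
    have h2 := neg_abs_le lam
    nlinarith [sq_nonneg (dist (u x) w)]

/-- The energy decreases along a solution. If it exceeded an earlier value, then after the last
time `s` at which it does not, the EVI tested with `u s` would keep the curve at `u s`. -/
lemma IsEVISolution.energy_le (hφ : IsProperLSC φ) (hu : IsEVISolution φ lam u) {a b : ℝ}
    (ha : 0 < a) (hab : a ≤ b) : φ (u b) ≤ φ (u a) := by
  by_contra hcon
  have hlsc : LowerSemicontinuousOn (fun r => φ (u r)) (Icc a b) :=
    hφ.lsc.lowerSemicontinuousOn univ |>.comp (hu.continuousOn.mono fun r hr => ha.trans_le hr.1)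
      (mapsTo_univ _ _)
  have hcpt := hlsc.isCompact_inter_preimage_Iic isCompact_Icc (φ (u a))
  -- `s` exists because sublevel sets are closed by lower semicontinuity
  obtain ⟨s, ⟨hsI, hsa⟩, hmax⟩ := hcpt.exists_isGreatest
    ⟨a, left_mem_Icc.2 hab, show φ (u a) ≤ φ (u a) from le_rfl⟩
  have hs0 : 0 < s := ha.trans_le hsI.1
  have hsD := hu.mem_dom s hs0
  have hle : ∀ r ∈ Ico s b, (φ (u s)).toReal - (φ (u r)).toReal ≤ 0 := by
    intro r hr
    rw [sub_nonpos, hφ.toReal_le_toReal hsD (hu.mem_dom r (hs0.trans_le hr.1))]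
    rcases hr.1.eq_or_lt with rfl | hlt
    · exact le_rfl
    · refine le_trans hsa (le_of_not_ge fun h => hlt.not_ge (hmax ⟨⟨hsI.1.trans hr.1, hr.2.le⟩, h⟩))
  have h := hu.half_sq_dist_le_gronwallBound hφ hs0 hsI.2 hsD hle
  rw [dist_self, show (0 : ℝ) ^ 2 / 2 = 0 by norm_num, gronwallBound_ε0_δ0] at h
  have h0 : dist (u b) (u s) = 0 := by nlinarith [dist_nonneg (x := u b) (y := u s)]
  rw [dist_eq_zero] at h0
  exact hcon (h0 ▸ hsa)

/-- The EVI integrated over `[s, t]`. Since the energy decreases, its value at `t` may be used on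
the whole interval. -/
lemma IsEVISolution.half_sq_dist_sub_le (hφ : IsProperLSC φ) (hu : IsEVISolution φ lam u)
    (hc : ContinuousOn u (Ici 0)) {s t : ℝ} (hs : 0 ≤ s) (hst : s ≤ t) {w : X} (hw : w ∈ Dom φ)
    {M : ℝ} (hM : ∀ r ∈ Ioo s t, -(lam / 2 * dist (u r) w ^ 2) ≤ M) :
    dist (u t) w ^ 2 / 2 - dist (u s) w ^ 2 / 2 ≤
      (t - s) * (M + (φ w).toReal - (φ (u t)).toReal) := by
  have h := sub_le_sub_of_eventually_slope_lt (f := fun r => dist (u r) w ^ 2 / 2)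
    (B := fun r => r * (M + (φ w).toReal - (φ (u t)).toReal))
    (B' := fun _ => (M + (φ w).toReal - (φ (u t)).toReal)) hst
    ((continuousOn_half_sq_dist hc (continuousOn_const (c := w))).mono fun r hr => hs.trans hr.1)
    (by fun_prop) (fun x _ => by simpa using (hasDerivAt_id x).mul_const _) ?_
  · linarith
  · intro r hr q hq
    have hr0 : 0 < r := hs.trans_lt hr.1
    refine hu.eventually_slope_lt hφ hr0 hw (lt_of_le_of_lt ?_ hq)
    have h1 := hM r hr
    have h2 := (hφ.toReal_le_toReal (hu.mem_dom t (hr0.trans hr.2)) (hu.mem_dom r hr0)).2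
      (hu.energy_le hφ hr0 hr.2.le)
    linarith

lemma IsEVISolution.energy_le_initial (hφ : IsProperLSC φ) (hu : IsEVISolution φ lam u)
    (hc : ContinuousOn u (Ici 0)) (h0 : u 0 ∈ Dom φ) {t : ℝ} (ht : 0 < t) :
    φ (u t) ≤ φ (u 0) := by
  rw [← hφ.toReal_le_toReal (hu.mem_dom t ht) h0]
  refine le_of_forall_pos_le_add fun ε hε => ?_
  have hcw : ContinuousWithinAt (fun r => -(lam / 2 * dist (u r) (u 0) ^ 2)) (Ici 0) 0 :=
    (((hc 0 self_mem_Ici).dist continuousWithinAt_const).pow 2).const_mul _ |>.neg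
  have hev : ∀ᶠ r in 𝓝[≥] 0, -(lam / 2 * dist (u r) (u 0) ^ 2) < ε :=
    hcw.tendsto.eventually (gt_mem_nhds (by simpa using hε))
  obtain ⟨δ, hδ, hb⟩ := (mem_nhdsGE_iff_exists_Ico_subset).1 hev
  have hm : 0 < min t (δ / 2) := lt_min ht (half_pos hδ)
  have h := hu.half_sq_dist_sub_le hφ hc le_rfl hm.le h0 (M := ε) (fun r hr =>
    (hb ⟨hr.1.le, hr.2.trans_le ((min_le_right _ _).trans (half_le_self
      (le_of_lt hδ)))⟩ : _ < _).le)
  have hle := (hφ.toReal_le_toReal (hu.mem_dom t ht) (hu.mem_dom _ hm)).2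
    (hu.energy_le hφ hm (min_le_left _ _))
  rw [dist_self] at h
  have h3 : 0 ≤ (min t (δ / 2) - 0) * (ε + (φ (u 0)).toReal - (φ (u (min t (δ / 2)))).toReal) := by
    linarith [sq_nonneg (dist (u (min t (δ / 2))) (u 0))]
  rw [sub_zero] at h3
  have := nonneg_of_mul_nonneg_right h3 hm
  linarith

lemma IsEVISolution.mem_dom' (hu : IsEVISolution φ lam u) (h0 : u 0 ∈ Dom φ) {t : ℝ}
    (ht : 0 ≤ t) : u t ∈ Dom φ := by
  rcases ht.eq_or_lt with rfl | ht
  exacts [h0, hu.mem_dom t ht]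

lemma IsEVISolution.antitoneOn_energy (hφ : IsProperLSC φ) (hu : IsEVISolution φ lam u)
    (hc : ContinuousOn u (Ici 0)) (h0 : u 0 ∈ Dom φ) :
    AntitoneOn (fun t => (φ (u t)).toReal) (Ici 0) := by
  intro a ha b hb hab
  refine (hφ.toReal_le_toReal (hu.mem_dom' h0 hb) (hu.mem_dom' h0 ha)).2 ?_
  rcases (mem_Ici.1 ha).eq_or_lt with rfl | ha
  · rcases hab.eq_or_lt with rfl | hab
    exacts [le_rfl, hu.energy_le_initial hφ hc h0 hab]
  · exact hu.energy_le hφ ha hab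

lemma exp_sub_one_le_mul_exp {x : ℝ} : Real.exp x - 1 ≤ x * Real.exp x := by
  have h := Real.add_one_le_exp (-x)
  have h2 : Real.exp x * Real.exp (-x) = 1 := by rw [← Real.exp_add]; simp
  nlinarith [Real.exp_pos x]

lemma gronwallBound_zero_le {K ε x : ℝ} (hK : 0 ≤ K) (hε : 0 ≤ ε) :
    gronwallBound 0 K ε x ≤ ε * x * Real.exp (K * x) := by
  rcases hK.eq_or_lt with rfl | hK
  · simp [gronwallBound_K0]
  · rw [gronwallBound_of_K_ne_0 hK.ne']
    have h := mul_le_mul_of_nonneg_left (exp_sub_one_le_mul_exp (x := K * x))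
      (div_nonneg hε hK.le)
    have e : ε / K * (K * x * Real.exp (K * x)) = ε * x * Real.exp (K * x) := by field_simp
    simp only [zero_mul, zero_add]
    linarith

/-- The squared displacement of a solution is controlled by the elapsed time and the energy drop:
Grönwall's inequality for the distance to the earlier position. -/
lemma IsEVISolution.sq_dist_le (hφ : IsProperLSC φ) (hu : IsEVISolution φ lam u)
    (hc : ContinuousOn u (Ici 0)) (h0 : u 0 ∈ Dom φ) {s t : ℝ} (hs : 0 ≤ s) (hst : s ≤ t) :
    dist (u s) (u t) ^ 2 ≤ 2 * Real.exp (|lam| * t) *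
      ((t - s) * ((φ (u s)).toReal - (φ (u t)).toReal)) := by
  have hanti := hu.antitoneOn_energy hφ hc h0
  have key : ∀ s, 0 < s → s ≤ t → dist (u s) (u t) ^ 2 ≤ 2 * Real.exp (|lam| * t) *
      ((t - s) * ((φ (u s)).toReal - (φ (u t)).toReal)) := by
    intro s hs hst
    have hE : 0 ≤ (φ (u s)).toReal - (φ (u t)).toReal :=
      sub_nonneg.2 (hanti hs.le (hs.le.trans hst) hst)
    have h := hu.half_sq_dist_le_gronwallBound hφ hs hst (hu.mem_dom s hs)
      (c := (φ (u s)).toReal - (φ (u t)).toReal) fun r hr =>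
        sub_le_sub_left (hanti (hs.le.trans hr.1) (hs.le.trans hst) hr.2.le) _
    rw [dist_self, show (0 : ℝ) ^ 2 / 2 = 0 by norm_num] at h
    have h2 := h.trans (gronwallBound_zero_le (abs_nonneg lam) hE)
    have h3 : Real.exp (|lam| * (t - s)) ≤ Real.exp (|lam| * t) :=
      Real.exp_le_exp.2 (mul_le_mul_of_nonneg_left (by linarith) (abs_nonneg _))
    have h4 := mul_le_mul_of_nonneg_left h3 (mul_nonneg hE (sub_nonneg.2 hst))
    rw [dist_comm]
    linarith
  rcases hs.eq_or_lt with rfl | hs'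
  · rcases hst.eq_or_lt with rfl | ht
    · simp
    have hmono : 𝓝[>] (0 : ℝ) ≤ 𝓝[Ici 0] 0 := nhdsWithin_mono _ Ioi_subset_Ici_self
    refine le_of_tendsto (x := 𝓝[>] (0 : ℝ)) (f := fun s => dist (u s) (u t) ^ 2)
      (((((hc 0 self_mem_Ici).mono_left hmono).dist tendsto_const_nhds).pow 2)) ?_
    filter_upwards [Ioo_mem_nhdsGT ht] with s hs
    refine (key s hs.1 hs.2.le).trans ?_
    have h1 : (φ (u s)).toReal ≤ (φ (u 0)).toReal := hanti self_mem_Ici hs.1.le hs.1.le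
    have h2 : (φ (u t)).toReal ≤ (φ (u s)).toReal := hanti hs.1.le (mem_Ici.2 ht.le) hs.2.le
    have h3 := hs.1
    gcongr
  · exact key s hs' hst

/-- The `λ`-contraction property of solutions. -/
lemma IsEVISolution.dist_le_exp_mul_dist (hφ : IsProperLSC φ) (hu : IsEVISolution φ lam u)
    (hv : IsEVISolution φ lam v) (hcu : ContinuousOn u (Ici 0)) (hcv : ContinuousOn v (Ici 0))
    {t : ℝ} (ht : 0 ≤ t) : dist (u t) (v t) ≤ Real.exp (-lam * t) * dist (u 0) (v 0) := by
  rcases ht.eq_or_lt with rfl | ht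
  · simp
  have hcont : ContinuousOn (fun r => dist (u r) (v r) ^ 2 / 2) (Ici 0) :=
    continuousOn_half_sq_dist hcu hcv
  have hdini : ∀ x, 0 < x → ∀ r, -2 * lam * (dist (u x) (v x) ^ 2 / 2) < r →
      ∀ᶠ z in 𝓝[>] x, _root_.slope (fun r => dist (u r) (v r) ^ 2 / 2) x z < r := by
    intro x hx r hr
    obtain ⟨ε, hε, hr⟩ : ∃ ε > 0, -2 * lam * (dist (u x) (v x) ^ 2 / 2) + 3 * ε < r :=
      ⟨(r - -2 * lam * (dist (u x) (v x) ^ 2 / 2)) / 4, by linarith, by linarith⟩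
    have hux := hu.continuousOn.continuousAt (Ioi_mem_nhds hx)
    have hvx := hv.continuousOn.continuousAt (Ioi_mem_nhds hx)
    have hjoint : ∀ᶠ p : ℝ × ℝ in 𝓝 (x, x), -(lam / 2 * dist (u p.1) (v p.2) ^ 2) <
        -(lam / 2 * dist (u x) (v x) ^ 2) + ε := by
      have h1 : ContinuousAt (fun p : ℝ × ℝ => u p.1) (x, x) :=
        ContinuousAt.comp (f := Prod.fst) (g := u) hux continuousAt_fst
      have h2 : ContinuousAt (fun p : ℝ × ℝ => v p.2) (x, x) :=
        ContinuousAt.comp (f := Prod.snd) (g := v) hvx continuousAt_snd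
      have h3 : ContinuousAt (fun p : ℝ × ℝ => -(lam / 2 * dist (u p.1) (v p.2) ^ 2)) (x, x) :=
        (((h1.dist h2).pow 2).const_mul _).neg
      exact h3.eventually (gt_mem_nhds (by simpa using hε))
    obtain ⟨δ, hδ, hball⟩ := Metric.eventually_nhds_iff.1 hjoint
    -- The increment of the squared distance is split into one along `u`, tested with the moving
    -- point `v z` in the integrated EVI, and one along `v`, tested with the fixed point `u x`.
    have hsecond := hv.eventually_slope_lt hφ hx (hu.mem_dom x hx)
      (r := (φ (u x)).toReal - (φ (v x)).toReal - lam / 2 * dist (v x) (u x) ^ 2 + ε) (by linarith)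
    have hlsc := (hux.tendsto.eventually (hφ.eventually_lt_toReal (hu.mem_dom x hx)
      (c := (φ (u x)).toReal - ε) (by linarith))).filter_mono (nhdsWithin_le_nhds (s := Ioi x))
    filter_upwards [hsecond, hlsc, Ioo_mem_nhdsGT (show x < x + δ by linarith)] with z hz1 hz2 hz
    have hzx : 0 < z - x := sub_pos.2 hz.1
    have hz0 : 0 < z := hx.trans hz.1
    have hfirst := hu.half_sq_dist_sub_le hφ hcu hx.le hz.1.le (hv.mem_dom z hz0)
      (M := -(lam / 2 * dist (u x) (v x) ^ 2) + ε) (fun q hq => by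
        refine (@hball (q, z) ?_).le
        rw [Prod.dist_eq, max_lt_iff, Real.dist_eq, Real.dist_eq, abs_lt, abs_lt]
        refine ⟨⟨?_, ?_⟩, ?_, ?_⟩ <;> simp only <;> linarith [hq.1, hq.2, hz.2])
    have hv' := (hφ.toReal_le_toReal (hv.mem_dom z hz0) (hv.mem_dom x hx)).2
      (hv.energy_le hφ hx hz.1.le)
    have hu' := hz2 (hu.mem_dom z hz0)
    rw [slope_def_field, div_lt_iff₀ hzx] at hz1 ⊢
    have hfirst' : (z - x) * (-(lam / 2 * dist (u x) (v x) ^ 2) + ε + (φ (v z)).toReal -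
        (φ (u z)).toReal) ≤ (z - x) * (-(lam / 2 * dist (u x) (v x) ^ 2) + 2 * ε +
        (φ (v x)).toReal - (φ (u x)).toReal) :=
      mul_le_mul_of_nonneg_left (by linarith) hzx.le
    have hr' := mul_lt_mul_of_pos_right hr hzx
    rw [dist_comm (v x), dist_comm (v z)] at hz1
    linarith
  have hgron : ∀ s ∈ Ioo 0 t, dist (u t) (v t) ^ 2 / 2 ≤
      dist (u s) (v s) ^ 2 / 2 * Real.exp (-2 * lam * (t - s)) := by
    intro s hs
    have := le_gronwallBound_of_liminf_deriv_right_le (f := fun r => dist (u r) (v r) ^ 2 / 2)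
      (f' := fun r => -2 * lam * (dist (u r) (v r) ^ 2 / 2)) (K := -2 * lam) (ε := 0)
      (a := s) (b := t) (hcont.mono fun r hr => hs.1.le.trans hr.1)
      (fun x hx r hr => ((hdini x (hs.1.trans_le hx.1) r hr).mono fun z hz => by
        simpa [_root_.slope, smul_eq_mul] using hz).frequently) le_rfl
      (fun x _ => by linarith) t (right_mem_Icc.2 hs.2.le)
    rwa [gronwallBound_ε0] at this
  have hlim : dist (u t) (v t) ^ 2 / 2 ≤
      dist (u 0) (v 0) ^ 2 / 2 * Real.exp (-2 * lam * (t - 0)) := by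
    have hmono : 𝓝[>] (0 : ℝ) ≤ 𝓝[Ici 0] 0 := nhdsWithin_mono _ Ioi_subset_Ici_self
    refine ge_of_tendsto (x := 𝓝[>] (0 : ℝ))
      (f := fun s => dist (u s) (v s) ^ 2 / 2 * Real.exp (-2 * lam * (t - s)))
      (((hcont 0 self_mem_Ici).mono_left hmono).mul
        (((by fun_prop : Continuous fun s : ℝ => Real.exp (-2 * lam * (t - s))).tendsto 0).mono_left
          nhdsWithin_le_nhds)) ?_
    filter_upwards [Ioo_mem_nhdsGT ht] with s hs using hgron s hs
  have hexp : Real.exp (-2 * lam * (t - 0)) = Real.exp (-lam * t) ^ 2 := by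
    rw [← Real.exp_nat_mul]; congr 1; push_cast; ring
  rw [hexp] at hlim
  refine le_of_sq_le_sq ?_ (by positivity)
  rw [mul_pow]
  linarith

/-! ### The metric slope at the starting point of a solution -/

lemma IsProperLSC.toENNReal_sub (hφ : IsProperLSC φ) {x y : X} (hx : x ∈ Dom φ) (hy : y ∈ Dom φ) :
    (φ x - φ y).toENNReal = ENNReal.ofReal ((φ x).toReal - (φ y).toReal) := by
  rw [← hφ.coe_toReal hx, ← hφ.coe_toReal hy, ← EReal.coe_sub, EReal.toENNReal_of_ne_top
    (EReal.coe_ne_top _)]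
  simp only [EReal.toReal_coe]

lemma slope_eq_limsup {x : X} (hx : x ∈ Dom φ) :
    slope φ x = limsup (fun y => (φ x - φ y).toENNReal / edist x y) (𝓝[≠] x) := by
  simp [slope, hx]

lemma IsProperLSC.eventually_sub_le_of_slope_lt (hφ : IsProperLSC φ) {x : X} (hx : x ∈ Dom φ)
    {c : ℝ} (h : slope φ x < ENNReal.ofReal c) :
    ∀ᶠ y in 𝓝 x, y ∈ Dom φ → (φ x).toReal - (φ y).toReal ≤ c * dist x y := by
  have hc : 0 ≤ c := (ENNReal.ofReal_pos.1 (bot_le.trans_lt h)).le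
  rw [slope_eq_limsup hx] at h
  have hev := eventually_lt_of_limsup_lt h
  rw [eventually_nhdsWithin_iff] at hev
  filter_upwards [hev] with y hy hyD
  by_cases hxy : y = x
  · simp [hxy]
  have h1 := hy hxy
  have hd : 0 < dist x y := dist_pos.2 (Ne.symm hxy)
  rw [hφ.toENNReal_sub hx hyD, edist_dist, ← ENNReal.ofReal_div_of_pos hd] at h1
  have h2 := (ENNReal.ofReal_lt_ofReal_iff'.1 h1).1
  rw [div_lt_iff₀ hd] at h2
  exact h2.le

lemma IsProperLSC.slope_le_ofReal (hφ : IsProperLSC φ) {x : X} (hx : x ∈ Dom φ) {c : ℝ}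
    (h : ∀ᶠ y in 𝓝[≠] x, y ∈ Dom φ → (φ x).toReal - (φ y).toReal ≤ c * dist x y) :
    slope φ x ≤ ENNReal.ofReal c := by
  rw [slope_eq_limsup hx]
  refine limsup_le_of_le (by isBoundedDefault) ?_
  filter_upwards [h, self_mem_nhdsWithin] with y hy hxy
  have hd : 0 < dist x y := dist_pos.2 (Ne.symm hxy)
  by_cases hyD : y ∈ Dom φ
  · rw [hφ.toENNReal_sub hx hyD, edist_dist, ← ENNReal.ofReal_div_of_pos hd]
    refine ENNReal.ofReal_le_ofReal ?_
    rw [div_le_iff₀ hd]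
    exact hy hyD
  · have htop : φ y = ⊤ := not_lt_top_iff.1 hyD
    simp [htop]

lemma IsProperLSC.slope_le_of_forall (hφ : IsProperLSC φ) {x : X} (hx : x ∈ Dom φ) {c C : ℝ}
    (hc : 0 ≤ c) (h : ∀ y ∈ Dom φ, (φ x).toReal - (φ y).toReal ≤ c * dist x y + C * dist x y ^ 2) :
    slope φ x ≤ ENNReal.ofReal c := by
  refine ENNReal.le_of_forall_pos_le_add fun ε hε _ => ?_
  rw [← ENNReal.ofReal_coe_nnreal, ← ENNReal.ofReal_add hc ε.coe_nonneg]
  refine hφ.slope_le_ofReal hx ?_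
  have hcont : Tendsto (fun y => C * dist x y) (𝓝 x) (𝓝 (C * dist x x)) :=
    Continuous.tendsto (by fun_prop) x
  rw [dist_self, mul_zero] at hcont
  filter_upwards [(hcont.eventually (gt_mem_nhds (show (0 : ℝ) < ε from hε))).filter_mono
    nhdsWithin_le_nhds] with y hy hyD
  have h1 := h y hyD
  nlinarith [dist_nonneg (x := x) (y := y)]

lemma tendsto_nhdsGT_zero_of_continuousOn (hc : ContinuousOn u (Ici 0)) :
    Tendsto u (𝓝[>] 0) (𝓝 (u 0)) :=
  (hc 0 self_mem_Ici).mono_left (nhdsWithin_mono _ Ioi_subset_Ici_self)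

/-- A solution leaves its starting point with a speed not exceeding the slope there. -/
lemma IsEVISolution.eventually_dist_le (hφ : IsProperLSC φ) (hu : IsEVISolution φ lam u)
    (hc : ContinuousOn u (Ici 0)) (h0 : u 0 ∈ Dom φ) {c : ℝ}
    (hslope : slope φ (u 0) < ENNReal.ofReal c) :
    ∃ δ > 0, ∀ t ∈ Ico 0 δ, dist (u t) (u 0) ≤ c * t := by
  obtain ⟨b, hb1, hb2⟩ := exists_between hslope
  obtain ⟨c', rfl⟩ : ∃ c' : ℝ, b = ENNReal.ofReal c' :=
    ⟨b.toReal, (ENNReal.ofReal_toReal (ne_top_of_lt hb2)).symm⟩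
  have hc' : c' < c := (ENNReal.ofReal_lt_ofReal_iff'.1 hb2).1
  have hcpos : 0 < c := (ENNReal.ofReal_lt_ofReal_iff'.1 hb2).2
  have hlim := tendsto_nhdsGT_zero_of_continuousOn hc
  have hev1 := hlim.eventually (hφ.eventually_sub_le_of_slope_lt h0 hb1)
  have hlim2 : Tendsto (fun t => |lam| / 2 * dist (u t) (u 0)) (𝓝[>] 0)
      (𝓝 (|lam| / 2 * dist (u 0) (u 0))) := (hlim.dist tendsto_const_nhds).const_mul _
  rw [dist_self, mul_zero] at hlim2
  have hev2 := hlim2.eventually (gt_mem_nhds (sub_pos.2 hc'))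
  obtain ⟨δ, hδ, hev⟩ := mem_nhdsGT_iff_exists_Ioo_subset.1 (hev1.and hev2)
  refine ⟨δ, hδ, fun t ht => ?_⟩
  rcases ht.1.eq_or_lt with rfl | ht0
  · simp
  -- comparison on `[s, t]` with half the square of an affine function, positive at `s`
  have key : ∀ s ∈ Ioo 0 t, dist (u t) (u 0) ≤ dist (u s) (u 0) + s + c * (t - s) := by
    intro s hs
    have hds := dist_nonneg (x := u s) (y := u 0)
    have hcomp := image_le_of_liminf_slope_right_lt_deriv_boundary'
      (f := fun r => dist (u r) (u 0) ^ 2 / 2)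
      (f' := fun r => (φ (u 0)).toReal - (φ (u r)).toReal - lam / 2 * dist (u r) (u 0) ^ 2)
      (a := s) (b := t)
      (B := fun r => (dist (u s) (u 0) + s + c * (r - s)) ^ 2 / 2)
      (B' := fun r => c * (dist (u s) (u 0) + s + c * (r - s)))
      ((continuousOn_half_sq_dist hc continuousOn_const).mono fun r hr => hs.1.le.trans hr.1)
      (fun x hx r hr =>
        (hu.eventually_slope_lt hφ (hs.1.trans_le hx.1) h0 hr).frequently)
      ?_ (by fun_prop) ?_ ?_ (right_mem_Icc.2 hs.2.le)
    · have hpos : 0 ≤ dist (u s) (u 0) + s + c * (t - s) := by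
        have := mul_pos hcpos (sub_pos.2 hs.2)
        linarith [hs.1]
      refine le_of_sq_le_sq ?_ hpos
      linarith
    · simp only [sub_self, mul_zero, add_zero]
      have := hs.1
      gcongr
      linarith
    · intro x _
      have h1 : HasDerivAt (fun r => dist (u s) (u 0) + s + c * (r - s)) c x := by
        simpa using (((hasDerivAt_id x).sub_const s).const_mul c).const_add (dist (u s) (u 0) + s)
      have h2 := (h1.pow 2).div_const 2
      refine (h2.congr_deriv ?_).hasDerivWithinAt
      norm_num
      ring
    · intro x hx heq
      have hx0 : 0 < x := hs.1.trans_le hx.1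
      obtain ⟨h1, h2⟩ := hev ⟨hx0, hx.2.trans ht.2⟩
      have h1' := h1 (hu.mem_dom x hx0)
      have hpos : 0 < dist (u s) (u 0) + s + c * (x - s) := by
        have := mul_nonneg hcpos.le (sub_nonneg.2 hx.1)
        linarith [hs.1]
      have hd : dist (u x) (u 0) = dist (u s) (u 0) + s + c * (x - s) := by
        refine (sq_eq_sq₀ dist_nonneg hpos.le).1 ?_
        linarith
      rw [← hd] at hpos ⊢
      rw [dist_comm] at h1'
      have h3 := mul_lt_mul_of_pos_right h2 hpos
      have h4 := mul_le_mul_of_nonneg_right (neg_abs_le lam) (sq_nonneg (dist (u x) (u 0)))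
      linarith
  have hl : Tendsto (fun s => dist (u s) (u 0) + s + c * (t - s)) (𝓝[>] 0)
      (𝓝 (dist (u 0) (u 0) + 0 + c * (t - 0))) :=
    ((hlim.dist tendsto_const_nhds).add (tendsto_id.mono_left nhdsWithin_le_nhds)).add
      ((Continuous.tendsto (by fun_prop : Continuous fun s : ℝ => c * (t - s)) 0).mono_left
        nhdsWithin_le_nhds)
  have := ge_of_tendsto hl (by filter_upwards [Ioo_mem_nhdsGT ht0] with s hs using key s hs)
  simpa using this

/-- At the starting point of a solution the local slope controls the energy globally. -/
lemma IsEVISolution.sub_le_slope_mul_dist (hφ : IsProperLSC φ) (hu : IsEVISolution φ lam u)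
    (hc : ContinuousOn u (Ici 0)) (h0 : u 0 ∈ Dom φ) (hslope : slope φ (u 0) ≠ ⊤) {y : X}
    (hy : y ∈ Dom φ) :
    (φ (u 0)).toReal - (φ y).toReal ≤
      (slope φ (u 0)).toReal * dist (u 0) y - lam / 2 * dist (u 0) y ^ 2 := by
  have key : ∀ ε > 0, (φ (u 0)).toReal - (φ y).toReal ≤
      ((slope φ (u 0)).toReal + ε) * dist (u 0) y - lam / 2 * dist (u 0) y ^ 2 + 2 * ε := by
    intro ε hε
    have hlt : slope φ (u 0) < ENNReal.ofReal ((slope φ (u 0)).toReal + ε) := by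
      rw [ENNReal.lt_ofReal_iff_toReal_lt hslope]
      linarith
    obtain ⟨δ, hδ, hrate⟩ := hu.eventually_dist_le hφ hc h0 hlt
    have hlim := tendsto_nhdsGT_zero_of_continuousOn hc
    have hev1 := hlim.eventually (hφ.eventually_lt_toReal h0
      (c := (φ (u 0)).toReal - ε) (by linarith))
    have hlim2 : Tendsto (fun t => -(lam / 2 * dist (u t) y ^ 2)) (𝓝[>] 0)
        (𝓝 (-(lam / 2 * dist (u 0) y ^ 2))) :=
      (((hlim.dist tendsto_const_nhds).pow 2).const_mul _).neg
    have hev2 := hlim2.eventually (gt_mem_nhds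
      (show -(lam / 2 * dist (u 0) y ^ 2) < -(lam / 2 * dist (u 0) y ^ 2) + ε by linarith))
    obtain ⟨δ', hδ', hev⟩ := mem_nhdsGT_iff_exists_Ioo_subset.1 (hev1.and hev2)
    obtain ⟨t, ht0, ht⟩ := exists_between (lt_min hδ hδ')
    obtain ⟨htδ, htδ'⟩ := lt_min_iff.1 ht
    have h1 := hrate t ⟨ht0.le, htδ⟩
    have h2 := (hev ⟨ht0, htδ'⟩).1 (hu.mem_dom t ht0)
    have h3 := hu.half_sq_dist_sub_le hφ hc le_rfl ht0.le hy
      (M := -(lam / 2 * dist (u 0) y ^ 2) + ε)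
      (fun r hr => (hev ⟨hr.1, hr.2.trans htδ'⟩).2.le)
    have htri := dist_triangle_left (u 0) y (u t)
    set g := (slope φ (u 0)).toReal
    have hg : 0 ≤ g := ENNReal.toReal_nonneg
    have hd0 := dist_nonneg (x := u 0) (y := y)
    have hdt := dist_nonneg (x := u t) (y := y)
    have h4 : -((g + ε) * t * dist (u 0) y) ≤ dist (u t) y ^ 2 / 2 - dist (u 0) y ^ 2 / 2 := by
      have hct : 0 ≤ (g + ε) * t := by positivity
      rcases le_total ((g + ε) * t) (dist (u 0) y) with hle | hle
      · have : (dist (u 0) y - (g + ε) * t) ^ 2 ≤ dist (u t) y ^ 2 :=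
          pow_le_pow_left₀ (by linarith) (by linarith) 2
        nlinarith [sq_nonneg ((g + ε) * t)]
      · nlinarith [mul_le_mul_of_nonneg_right hle hd0]
    have h5 : t * (-((g + ε) * dist (u 0) y)) ≤ t * (-(lam / 2 * dist (u 0) y ^ 2) + ε +
        (φ y).toReal - (φ (u t)).toReal) := by
      rw [sub_zero] at h3
      linarith
    have h6 := le_of_mul_le_mul_left h5 ht0
    linarith
  refine le_of_forall_pos_le_add fun ε hε => ?_
  have hd0 := dist_nonneg (x := u 0) (y := y)
  have h := key (ε / (dist (u 0) y + 2)) (by positivity)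
  have e : ε / (dist (u 0) y + 2) * (dist (u 0) y + 2) = ε := by field_simp
  linarith

/-- Along points at which the local slope controls the energy globally, the slope is lower
semicontinuous, since it is then a supremum of lower semicontinuous difference quotients. -/
lemma IsProperLSC.lowerSemicontinuousOn_slope (hφ : IsProperLSC φ) {E : Set X} (hE : E ⊆ Dom φ)
    (h : ∀ x ∈ E, slope φ x ≠ ⊤ → ∀ y ∈ Dom φ, (φ x).toReal - (φ y).toReal ≤
      (slope φ x).toReal * dist x y - lam / 2 * dist x y ^ 2) :
    LowerSemicontinuousOn (slope φ) E := by
  intro x hx c hc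
  obtain ⟨b, hcb, hb⟩ := ENNReal.lt_iff_exists_nnreal_btwn.1 hc
  obtain ⟨a, hca, hab⟩ := ENNReal.lt_iff_exists_nnreal_btwn.1 hcb
  have hab' : (a : ℝ) < b := by exact_mod_cast hab
  -- a point `y` whose difference quotient witnesses that the slope exceeds `a`, with the quadratic
  -- correction taken into account
  obtain ⟨y, ⟨hyx, hys⟩, hyD, hy⟩ : ∃ y, (y ≠ x ∧ |lam| / 2 * dist x y < b - a) ∧ y ∈ Dom φ ∧
      b * dist x y < (φ x).toReal - (φ y).toReal := by
    have hcont : Tendsto (fun y => |lam| / 2 * dist x y) (𝓝 x) (𝓝 (|lam| / 2 * dist x x)) :=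
      Continuous.tendsto (by fun_prop) x
    rw [dist_self, mul_zero] at hcont
    have hev := (hcont.eventually (gt_mem_nhds (sub_pos.2 hab'))).filter_mono
      (nhdsWithin_le_nhds (s := {x}ᶜ))
    have hfreq : ∃ᶠ y in 𝓝[≠] x, y ∈ Dom φ ∧ b * dist x y < (φ x).toReal - (φ y).toReal := by
      intro hcon
      refine hb.not_ge ?_
      rw [← ENNReal.ofReal_coe_nnreal]
      refine hφ.slope_le_ofReal (hE hx) (hcon.mono fun y hy hyD => ?_)
      exact not_lt.1 fun hlt => hy ⟨hyD, hlt⟩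
    obtain ⟨y, h1, h2, h3⟩ := (hfreq.and_eventually (hev.and self_mem_nhdsWithin)).exists
    exact ⟨y, ⟨h3, h2⟩, h1⟩
  have hd : 0 < dist x y := dist_pos.2 hyx.symm
  set H : X → ℝ := fun z => lam / 2 * dist z y ^ 2 - a * dist z y with hH
  have hgap : 0 < (φ x).toReal - (φ y).toReal + H x := by
    have h1 := mul_lt_mul_of_pos_right hys hd
    have h2 := mul_le_mul_of_nonneg_right (neg_abs_le lam) (sq_nonneg (dist x y))
    simp only [hH]
    linarith
  obtain ⟨η, hη, hη2⟩ : ∃ η > 0, (φ x).toReal - (φ y).toReal + H x = 2 * η :=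
    ⟨((φ x).toReal - (φ y).toReal + H x) / 2, by linarith, by ring⟩
  have hHc : Continuous H := by fun_prop
  have hev1 := hφ.eventually_lt_toReal (hE hx) (c := (φ x).toReal - η) (by linarith)
  have hev2 := hHc.continuousAt.eventually (lt_mem_nhds (show H x - η < H x by linarith))
  filter_upwards [hev1.filter_mono nhdsWithin_le_nhds, hev2.filter_mono nhdsWithin_le_nhds,
    self_mem_nhdsWithin] with z h1 h2 hz
  refine lt_of_lt_of_le hca ?_
  by_cases htop : slope φ z = ⊤
  · simp [htop]
  have h3 := h z hz htop y hyD
  have h4 := h1 (hE hz)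
  simp only [hH] at h2 hη2
  have h5 : a * dist z y < (slope φ z).toReal * dist z y := by linarith
  have h6 := lt_of_mul_lt_mul_right h5 dist_nonneg
  rw [← ENNReal.ofReal_toReal htop, ← ENNReal.ofReal_coe_nnreal]
  exact ENNReal.ofReal_le_ofReal h6.le

/-- If a curve `w` issued from the starting point `u 0` of a solution has there the speed `g` and
the energy dissipation rate `g ^ 2`, where `g` is the slope, then it is tangent to the solution. -/
lemma IsEVISolution.eventually_dist_le_mul (hφ : IsProperLSC φ) (hu : IsEVISolution φ lam u)
    (hc : ContinuousOn u (Ici 0)) (h0 : u 0 ∈ Dom φ) (hslope : slope φ (u 0) ≠ ⊤) {w : ℝ → X}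
    (hw : ∀ h, 0 < h → w h ∈ Dom φ)
    (hspeed : ∀ ε > 0, ∀ᶠ h in 𝓝[>] 0, dist (u 0) (w h) ≤ ((slope φ (u 0)).toReal + ε) * h)
    (henergy : ∀ ε > 0, ∀ᶠ h in 𝓝[>] 0, (φ (w h)).toReal - (φ (u 0)).toReal ≤
      (-(slope φ (u 0)).toReal ^ 2 + ε) * h) {ε : ℝ} (hε : 0 < ε) :
    ∀ᶠ h in 𝓝[>] 0, dist (u h) (w h) ≤ ε * h := by
  have hglobal := fun y hy => hu.sub_le_slope_mul_dist hφ hc h0 hslope (y := y) hy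
  have hrate : ∀ η > 0, ∃ δ > 0, ∀ t ∈ Ico 0 δ,
      dist (u t) (u 0) ≤ ((slope φ (u 0)).toReal + η) * t := by
    intro η hη
    refine hu.eventually_dist_le hφ hc h0 ?_
    rw [ENNReal.lt_ofReal_iff_toReal_lt hslope]
    linarith
  set g := (slope φ (u 0)).toReal
  have hg : 0 ≤ g := ENNReal.toReal_nonneg
  -- The bounds below add up to at most `η * (3 * g + 5) / 2 * h ^ 2` for half the squared distance.
  obtain ⟨η, hη, hη1, hη2⟩ : ∃ η > 0, η ≤ 1 ∧ η * (3 * g + 5) ≤ ε ^ 2 := by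
    refine ⟨min 1 (ε ^ 2 / (3 * g + 5)), by positivity, min_le_left _ _, ?_⟩
    rw [← le_div_iff₀ (by positivity)]
    exact min_le_right _ _
  obtain ⟨δ, hδ, hrate⟩ := hrate η hη
  set c := g + η with hcdef
  have hc0 : 0 < c := by positivity
  have hsmall : ∀ᶠ h : ℝ in 𝓝[>] 0, |lam| * (5 / 2) * c ^ 2 * h < η := by
    have : Tendsto (fun h : ℝ => |lam| * (5 / 2) * c ^ 2 * h) (𝓝 0)
        (𝓝 (|lam| * (5 / 2) * c ^ 2 * 0)) := Continuous.tendsto (by fun_prop) 0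
    rw [mul_zero] at this
    exact (this.eventually (gt_mem_nhds hη)).filter_mono nhdsWithin_le_nhds
  filter_upwards [hspeed η hη, henergy η hη, hsmall, Ioo_mem_nhdsGT hδ] with h h1 h2 h3 hh
  have hwD := hw h hh.1
  have hh0 := hh.1
  set A := (φ (w h)).toReal - (φ (u 0)).toReal + |lam| / 2 * (2 * c * h) ^ 2 +
    |lam| / 2 * (c * h) ^ 2 with hA
  -- Along `u` the energy falls by at most `g * c * s` up to time `s`, to first order; with the
  -- fixed test point `w h` the EVI then bounds the derivative by an affine function of `s`.
  have hcomp := sub_le_sub_of_eventually_slope_lt (f := fun s => dist (u s) (w h) ^ 2 / 2)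
    (B := fun s => s * A + s ^ 2 * (g * c / 2)) (B' := fun s => A + s * (g * c)) hh0.le
    ((continuousOn_half_sq_dist hc continuousOn_const).mono fun r hr => hr.1) (by fun_prop)
    (fun x _ => by
      have := ((hasDerivAt_id x).mul_const A).add (((hasDerivAt_id x).pow 2).mul_const (g * c / 2))
      refine this.congr_deriv ?_
      simp
      ring) ?_
  · have h4 : dist (u 0) (w h) ^ 2 ≤ (c * h) ^ 2 := pow_le_pow_left₀ dist_nonneg h1 2
    have h5 : h * A ≤ h * ((-g ^ 2 + η) * h + |lam| * (5 / 2) * c ^ 2 * h * h) :=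
      mul_le_mul_of_nonneg_left (by rw [hA]; nlinarith) hh0.le
    have h6 : h ^ 2 * (|lam| * (5 / 2) * c ^ 2 * h) ≤ h ^ 2 * η :=
      mul_le_mul_of_nonneg_left h3.le (sq_nonneg h)
    have h7 : h ^ 2 * (η * (3 * g + 5)) ≤ h ^ 2 * ε ^ 2 :=
      mul_le_mul_of_nonneg_left hη2 (sq_nonneg h)
    have h8 : h ^ 2 * (η * η) ≤ h ^ 2 * (η * 1) := by gcongr
    refine le_of_sq_le_sq ?_ (by positivity)
    rw [hcdef] at h4 hcomp
    simp only [hcdef] at h5 h6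
    nlinarith
  · intro s hs r hr
    refine hu.eventually_slope_lt hφ hs.1 hwD (lt_of_le_of_lt ?_ hr)
    have hds := hrate s ⟨hs.1.le, hs.2.trans hh.2⟩
    have hgl := hglobal (u s) (hu.mem_dom s hs.1)
    rw [dist_comm] at hgl
    have h4 : dist (u s) (w h) ≤ 2 * c * h := by
      have := dist_triangle (u s) (u 0) (w h)
      have := mul_le_mul_of_nonneg_left hs.2.le hc0.le
      linarith
    have h5 : dist (u s) (u 0) ≤ c * h :=
      hds.trans (mul_le_mul_of_nonneg_left hs.2.le hc0.le)
    have h6 : |lam| / 2 * dist (u s) (w h) ^ 2 ≤ |lam| / 2 * (2 * c * h) ^ 2 := by gcongr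
    have h7 : |lam| / 2 * dist (u s) (u 0) ^ 2 ≤ |lam| / 2 * (c * h) ^ 2 := by gcongr
    have h8 := mul_le_mul_of_nonneg_right (neg_abs_le lam) (sq_nonneg (dist (u s) (w h)))
    have h9 := mul_le_mul_of_nonneg_right (neg_abs_le lam) (sq_nonneg (dist (u s) (u 0)))
    have h10 := mul_le_mul_of_nonneg_left hds hg
    linarith

/-! ### Metric speed of absolutely continuous curves and an averaged chain rule -/

/-- The metric derivative of a continuous curve is a countable infimum of lower semicontinuous
functions. -/
lemma measurable_metricDeriv (hv : Continuous v) : Measurable (metricDeriv v) := by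
  have h : metricDeriv v = fun t => ⨅ n : ℕ, ⨆ h ∈ Metric.ball (0 : ℝ) (1 / (n + 1)) ∩ {0}ᶜ,
      edist (v (t + h)) (v t) / ENNReal.ofReal |h| := by
    funext t
    rw [metricDeriv, (nhdsWithin_hasBasis Metric.nhds_basis_ball_inv_nat_succ
      {(0 : ℝ)}ᶜ).limsup_eq_iInf_iSup]
    simp
  rw [h]
  refine Measurable.iInf fun n => LowerSemicontinuous.measurable ?_
  refine lowerSemicontinuous_biSup fun h hh => Continuous.lowerSemicontinuous ?_
  have hpos : ENNReal.ofReal |h| ≠ 0 := by simpa using hh.2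
  have he : Continuous fun t => edist (v (t + h)) (v t) := by fun_prop
  exact (ENNReal.continuous_div_const _ hpos).comp he

lemma metricDeriv_congr {t : ℝ} (h : u =ᶠ[𝓝 t] v) : metricDeriv u t = metricDeriv v t := by
  have ht : Tendsto (fun h : ℝ => t + h) (𝓝[≠] 0) (𝓝 t) := by
    have : Tendsto (fun h : ℝ => t + h) (𝓝 0) (𝓝 (t + 0)) := Continuous.tendsto (by fun_prop) 0
    rw [add_zero] at this
    exact this.mono_left nhdsWithin_le_nhds
  refine limsup_congr ?_
  filter_upwards [ht.eventually h] with x hx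
  rw [hx, h.eq_of_nhds]

lemma aemeasurable_metricDeriv (hv : ContinuousOn v (Ici 0)) :
    AEMeasurable (metricDeriv v) (volume.restrict (Ioi 0)) := by
  have hc : Continuous fun t => v (max 0 t) :=
    hv.comp_continuous (by fun_prop) fun t => mem_Ici.2 (le_max_left _ _)
  refine ⟨_, measurable_metricDeriv hc, ?_⟩
  filter_upwards [ae_restrict_mem measurableSet_Ioi] with t ht
  refine metricDeriv_congr ?_
  filter_upwards [Ioi_mem_nhds ht] with s hs
  rw [max_eq_right (le_of_lt hs)]

lemma eventually_dist_le_of_metricDeriv_lt {t r : ℝ} (h : metricDeriv v t < ENNReal.ofReal r) :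
    ∀ᶠ z in 𝓝[>] t, dist (v z) (v t) ≤ r * (z - t) := by
  have hr : 0 < r := ENNReal.ofReal_pos.1 (bot_le.trans_lt h)
  have hev := (eventually_lt_of_limsup_lt h).filter_mono
    (nhdsWithin_mono 0 (s := Ioi (0 : ℝ)) fun x hx => ne_of_gt hx)
  filter_upwards [(tendsto_sub_nhdsGT t).eventually hev, self_mem_nhdsWithin] with z hz hzt
  have hzt' : 0 < z - t := sub_pos.2 hzt
  rw [add_sub_cancel, abs_of_pos hzt', edist_dist, ← ENNReal.ofReal_div_of_pos hzt'] at hz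
  have := (ENNReal.ofReal_lt_ofReal_iff'.1 hz).1
  rw [div_lt_iff₀ hzt'] at this
  exact this.le

lemma metricDeriv_le_ofReal {t r : ℝ} (h : ∀ᶠ z in 𝓝[≠] t, dist (v z) (v t) ≤ r * |z - t|) :
    metricDeriv v t ≤ ENNReal.ofReal r := by
  have ht : Tendsto (fun h : ℝ => t + h) (𝓝[≠] 0) (𝓝[≠] t) := by
    refine tendsto_nhdsWithin_iff.2 ⟨?_, ?_⟩
    · have : Tendsto (fun h : ℝ => t + h) (𝓝 0) (𝓝 (t + 0)) := Continuous.tendsto (by fun_prop) 0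
      rw [add_zero] at this
      exact this.mono_left nhdsWithin_le_nhds
    · filter_upwards [self_mem_nhdsWithin] with x hx
      simpa using hx
  refine limsup_le_of_le (by isBoundedDefault) ?_
  filter_upwards [ht.eventually h, self_mem_nhdsWithin] with x hx hx0
  have hpos : 0 < |x| := abs_pos.2 hx0
  rw [edist_dist, ← ENNReal.ofReal_div_of_pos hpos]
  refine ENNReal.ofReal_le_ofReal ?_
  rw [div_le_iff₀ hpos]
  simpa using hx

lemma absolutelyContinuousOnInterval_of_dist_le {Y Z : Type*} [PseudoMetricSpace Y]
    [PseudoMetricSpace Z] {f : ℝ → Y} {P : ℝ → Z} {a b : ℝ}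
    (hP : AbsolutelyContinuousOnInterval P a b)
    (h : ∀ s ∈ uIcc a b, ∀ t ∈ uIcc a b, dist (f s) (f t) ≤ dist (P s) (P t)) :
    AbsolutelyContinuousOnInterval f a b := by
  rw [absolutelyContinuousOnInterval_iff] at hP ⊢
  intro ε hε
  obtain ⟨δ, hδ, hP⟩ := hP ε hε
  refine ⟨δ, hδ, fun E hE hEδ => (Finset.sum_le_sum fun i hi => ?_).trans_lt (hP E hE hEδ)⟩
  exact h _ (hE.1 i hi).1 _ (hE.1 i hi).2

/-- A curve dominated by an absolutely continuous function moves by at most the integral of its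
right metric speed. -/
lemma ofReal_dist_le_lintegral {P : ℝ → ℝ} {a b : ℝ} (hab : a ≤ b)
    (hP : AbsolutelyContinuousOnInterval P a b)
    (hv : ∀ s ∈ Icc a b, ∀ t ∈ Icc a b, dist (v s) (v t) ≤ dist (P s) (P t)) {m : ℝ → ℝ≥0∞}
    (hm : ∀ᵐ t, t ∈ Ioo a b → ∀ r, m t < ENNReal.ofReal r →
      ∃ᶠ z in 𝓝[>] t, dist (v z) (v t) ≤ r * (z - t)) :
    ENNReal.ofReal (dist (v a) (v b)) ≤ ∫⁻ t in Ioc a b, m t := by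
  set ρ : ℝ → ℝ := fun s => dist (v s) (v a) with hρ
  have hρd : ∀ s t, dist (ρ s) (ρ t) ≤ dist (v s) (v t) := fun s t => dist_dist_dist_le_left _ _ _
  have hac : AbsolutelyContinuousOnInterval ρ a b := by
    refine absolutelyContinuousOnInterval_of_dist_le hP fun s hs t ht => ?_
    rw [uIcc_of_le hab] at hs ht
    exact (hρd s t).trans (hv s hs t ht)
  have hint : dist (v a) (v b) = ∫ t in Ioc a b, deriv ρ t := by
    rw [← intervalIntegral.integral_of_le hab, hac.integral_deriv_eq_sub]
    simp [hρ, dist_comm]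
  have hle : ENNReal.ofReal (dist (v a) (v b)) ≤ ∫⁻ t in Ioc a b, ‖deriv ρ t‖ₑ := by
    rw [hint]
    exact (Real.ofReal_le_enorm _).trans (enorm_integral_le_lintegral_enorm _)
  refine hle.trans ?_
  rw [restrict_Ioo_eq_restrict_Ioc.symm]
  refine lintegral_mono_ae ((ae_restrict_iff' measurableSet_Ioo).2 ?_)
  filter_upwards [hac.ae_differentiableAt, hm] with t hdiff hmt ht
  have hder := (hdiff (by rw [uIcc_of_le hab]; exact Ioo_subset_Icc_self ht)).hasDerivAt
  refine le_of_forall_gt fun c hc => ?_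
  obtain ⟨b', hb1, hb2⟩ := exists_between hc
  obtain ⟨r, rfl⟩ : ∃ r : ℝ, b' = ENNReal.ofReal r :=
    ⟨b'.toReal, (ENNReal.ofReal_toReal (ne_top_of_lt hb2)).symm⟩
  refine lt_of_le_of_lt ?_ hb2
  rw [← ofReal_norm]
  refine ENNReal.ofReal_le_ofReal ?_
  have hslope := tendsto_slope_nhdsGT hder
  refine le_of_tendsto_of_frequently hslope.norm ?_
  refine ((hmt ht r hb1).and_eventually self_mem_nhdsWithin).mono fun z hz => ?_
  have hzt : 0 < z - t := sub_pos.2 hz.2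
  rw [slope_def_field, norm_div, Real.norm_of_nonneg hzt.le, div_le_iff₀ hzt, ← dist_eq_norm]
  exact (hρd z t).trans hz.1

/-- The increments of a curve in `AC²` are dominated by those of the primitive of its density. -/
lemma ACOn.exists_absolutelyContinuous {a b : ℝ} (hab : a ≤ b) (hv : ACOn 2 (Icc a b) v) :
    ∃ P : ℝ → ℝ, AbsolutelyContinuousOnInterval P a b ∧
      ∀ s ∈ Icc a b, ∀ t ∈ Icc a b, dist (v s) (v t) ≤ dist (P s) (P t) := by
  obtain ⟨m, hm, hd⟩ := hv
  have hI : IntegrableOn m (Icc a b) := hm.integrable (by norm_num)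
  have hint : IntervalIntegrable m volume a b := by
    rwa [intervalIntegrable_iff_integrableOn_Icc_of_le hab]
  refine ⟨fun t => ∫ r in a..t, m r,
    hint.absolutelyContinuousOnInterval_intervalIntegral left_mem_uIcc, ?_⟩
  have hsub : ∀ t ∈ Icc a b, IntervalIntegrable m volume a t := fun t ht =>
    hint.mono_set (by rw [uIcc_of_le hab, uIcc_of_le ht.1]; exact Icc_subset_Icc_right ht.2)
  have key : ∀ s ∈ Icc a b, ∀ t ∈ Icc a b, s ≤ t →
      dist (v s) (v t) ≤ dist (∫ r in a..s, m r) (∫ r in a..t, m r) := by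
    intro s hs t ht hst
    rw [dist_comm (∫ r in a..s, m r), Real.dist_eq,
      intervalIntegral.integral_interval_sub_left (hsub t ht) (hsub s hs)]
    exact (hd s hs t ht hst).trans (le_abs_self _)
  intro s hs t ht
  rcases le_total s t with h | h
  · exact key s hs t ht h
  · rw [dist_comm (v s), dist_comm (∫ r in a..s, m r)]
    exact key t ht s hs h

lemma LocACOn.acOn (hv : LocACOn 2 (Ici 0) v) {a b : ℝ} (ha : 0 ≤ a) (hab : a ≤ b) :
    ACOn 2 (Icc a b) v :=
  hv a b hab fun _ hx => ha.trans hx.1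

lemma LocACOn.continuousOn (hv : LocACOn 2 (Ici 0) v) : ContinuousOn v (Ici 0) := by
  intro t ht
  have h01 : (0 : ℝ) ≤ t + 1 := by linarith [mem_Ici.1 ht]
  obtain ⟨P, hP, hd⟩ := (hv.acOn le_rfl h01).exists_absolutelyContinuous h01
  have htI : t ∈ Icc 0 (t + 1) := ⟨ht, by linarith⟩
  have hc : ContinuousWithinAt v (Icc 0 (t + 1)) t := by
    rw [ContinuousWithinAt, tendsto_iff_dist_tendsto_zero]
    have hPc := hP.continuousOn
    rw [uIcc_of_le h01] at hPc
    refine squeeze_zero' (Eventually.of_forall fun s => dist_nonneg) ?_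
      (tendsto_iff_dist_tendsto_zero.1 (hPc t htI))
    filter_upwards [self_mem_nhdsWithin] with s hs using hd s hs t htI
  refine hc.mono_of_mem_nhdsWithin ?_
  rw [← Ici_inter_Iic]
  exact inter_mem self_mem_nhdsWithin (mem_nhdsWithin_of_mem_nhds (Iic_mem_nhds (by linarith)))

/-- The length inequality: the metric derivative is an admissible density for the curve. -/
lemma LocACOn.ofReal_dist_le (hv : LocACOn 2 (Ici 0) v) {a b : ℝ} (ha : 0 ≤ a) (hab : a ≤ b) :
    ENNReal.ofReal (dist (v a) (v b)) ≤ ∫⁻ t in Ioc a b, metricDeriv v t := by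
  obtain ⟨P, hP, hd⟩ := (hv.acOn ha hab).exists_absolutelyContinuous hab
  refine ofReal_dist_le_lintegral hab hP hd (ae_of_all _ fun t _ r hr => ?_)
  exact (eventually_dist_le_of_metricDeriv_lt hr).frequently

lemma sq_lintegral_le {a b : ℝ} {m : ℝ → ℝ≥0∞} (hm : AEMeasurable m (volume.restrict (Ioc a b))) :
    (∫⁻ t in Ioc a b, m t) ^ 2 ≤ ENNReal.ofReal (b - a) * ∫⁻ t in Ioc a b, m t ^ 2 := by
  have h := ENNReal.lintegral_mul_le_Lp_mul_Lq (volume.restrict (Ioc a b))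
    Real.HolderConjugate.two_two hm (aemeasurable_const (b := (1 : ℝ≥0∞)))
  simp only [Pi.mul_apply, mul_one, ENNReal.rpow_two, one_pow, lintegral_const, one_mul,
    Measure.restrict_apply_univ, Real.volume_Ioc] at h
  have h2 := pow_le_pow_left₀ bot_le h 2
  refine h2.trans (le_of_eq ?_)
  rw [mul_pow, ← ENNReal.rpow_two, ← ENNReal.rpow_two, ← ENNReal.rpow_mul, ← ENNReal.rpow_mul]
  norm_num
  rw [mul_comm]

lemma integral_le_integral_of_ae_Ioo {f g : ℝ → ℝ} {a b : ℝ} (hab : a ≤ b)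
    (hf : IntervalIntegrable f volume a b) (hg : IntervalIntegrable g volume a b)
    (h : ∀ᵐ s, s ∈ Ioo a b → f s ≤ g s) : (∫ s in a..b, f s) ≤ ∫ s in a..b, g s := by
  refine intervalIntegral.integral_mono_ae_restrict hab hf hg ?_
  rw [← Measure.restrict_congr_set (Ioo_ae_eq_Icc (μ := volume) (a := a) (b := b))]
  exact (ae_restrict_iff' measurableSet_Ioo).2 h

/-- An averaged chain rule: a function satisfying a difference inequality in which the density `q`
is evaluated at one end point only, for almost every such point, satisfies the integrated
inequality. It is obtained by integrating the difference quotient with step `δ` and letting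
`δ → 0`; lower semicontinuity at the left end point and the difference inequality at the right end
point recover the values of the function from its averages. -/
lemma sub_le_integral_add_of_ae_sub_le {f P q : ℝ → ℝ} {a b κ C : ℝ} (hab : a < b) (hκ : 0 ≤ κ)
    (hC : 0 ≤ C) (hf : IntervalIntegrable f volume a (b + 1))
    (hP : MonotoneOn P (Icc a (b + 1))) (hPb : Tendsto P (𝓝[>] b) (𝓝 (P b)))
    (hq : IntervalIntegrable q volume a (b + 1)) (hq0 : ∀ s, 0 ≤ q s)
    (hfa : ∀ c < f a, ∀ᶠ s in 𝓝[>] a, c < f s)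
    (h : ∀ᵐ s, s ∈ Ioo a (b + 1) → ∀ t ∈ Icc a (b + 1),
      f s - f t ≤ |t - s| * q s + (κ + C * |t - s|) * |P t - P s|) :
    f a - f b ≤ (∫ s in a..b, q s) + κ * (P b - P a) := by
  have hsub : ∀ {g : ℝ → ℝ}, IntervalIntegrable g volume a (b + 1) → ∀ {s t : ℝ}, a ≤ s → s ≤ t →
      t ≤ b + 1 → IntervalIntegrable g volume s t := fun hg s t hs hst ht =>
    hg.mono_set (by
      rw [uIcc_of_le hst, uIcc_of_le (hs.trans (hst.trans ht))]; exact Icc_subset_Icc hs ht)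
  have hPi : IntervalIntegrable P volume a (b + 1) := by
    refine MonotoneOn.intervalIntegrable ?_
    rwa [uIcc_of_le (by linarith)]
  -- the inequality for averages over intervals of length `δ`
  have key : ∀ δ ∈ Ioo (0 : ℝ) 1, (∫ s in a..a + δ, f s) ≤ δ * (f b + ((∫ s in a..b, q s) +
      (∫ s in b..b + δ, q s) + (κ + C * δ) * ((P (b + δ) - P a) + (P (b + δ) - P b)))) := by
    intro δ hδ
    obtain ⟨hδ0, hδ1⟩ := hδ
    have hκδ : 0 ≤ κ + C * δ := by positivity
    have hshift : ∀ {g : ℝ → ℝ}, IntervalIntegrable g volume a (b + 1) →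
        IntervalIntegrable (fun s => g (s + δ)) volume a b := fun {g} hg => by
      have := (hsub hg (s := a + δ) (t := b + δ) (by linarith) (by linarith)
        (by linarith)).comp_add_right δ
      simpa using this
    have hswap : ∀ {g : ℝ → ℝ}, IntervalIntegrable g volume a (b + 1) →
        (∫ s in a..b, g (s + δ)) - ∫ s in a..b, g s =
          (∫ s in b..b + δ, g s) - ∫ s in a..a + δ, g s := by
      intro g hg
      rw [intervalIntegral.integral_comp_add_right]
      have h1 := intervalIntegral.integral_add_adjacent_intervals
        (hsub hg (s := a) (t := b) le_rfl hab.le (by linarith))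
        (hsub hg (s := b) (t := b + δ) hab.le (by linarith) (by linarith))
      have h2 := intervalIntegral.integral_add_adjacent_intervals
        (hsub hg (s := a) (t := a + δ) le_rfl (by linarith) (by linarith))
        (hsub hg (s := a + δ) (t := b + δ) (by linarith) (by linarith) (by linarith))
      linarith
    have hqab := hsub hq (s := a) (t := b) le_rfl hab.le (by linarith)
    have hPab := hsub hPi (s := a) (t := b) le_rfl hab.le (by linarith)
    have hfab := hsub hf (s := a) (t := b) le_rfl hab.le (by linarith)
    have h1 : (∫ s in a..b, f s - f (s + δ)) ≤
        ∫ s in a..b, (δ * q s + (κ + C * δ) * (P (s + δ) - P s)) := by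
      refine integral_le_integral_of_ae_Ioo hab.le (hfab.sub (hshift hf))
        ((hqab.const_mul _).add (((hshift hPi).sub hPab).const_mul _)) ?_
      filter_upwards [h] with s hs hsI
      have hle := hs ⟨hsI.1, by linarith [hsI.2]⟩ (s + δ) ⟨by linarith [hsI.1], by linarith [hsI.2]⟩
      have hPs : P s ≤ P (s + δ) := hP ⟨hsI.1.le, by linarith [hsI.2]⟩
        ⟨by linarith [hsI.1], by linarith [hsI.2]⟩ (by linarith)
      rwa [add_sub_cancel_left, abs_of_pos hδ0, abs_of_nonneg (sub_nonneg.2 hPs)] at hle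
    rw [intervalIntegral.integral_sub hfab (hshift hf), intervalIntegral.integral_add
      (hqab.const_mul _) (((hshift hPi).sub hPab).const_mul _), intervalIntegral.integral_const_mul,
      intervalIntegral.integral_const_mul, intervalIntegral.integral_sub (hshift hPi) hPab,
      hswap hPi] at h1
    have hswapf := hswap hf
    have hbI : b ∈ Icc a (b + 1) := ⟨hab.le, by linarith⟩
    have hbδI : b + δ ∈ Icc a (b + 1) := ⟨by linarith, by linarith⟩
    have haI : a ∈ Icc a (b + 1) := ⟨le_rfl, by linarith⟩
    have hPub : (∫ s in b..b + δ, P s) ≤ δ * P (b + δ) := by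
      have := intervalIntegral.integral_mono_on (show b ≤ b + δ by linarith)
        (hsub hPi hab.le (by linarith) (by linarith)) (intervalIntegrable_const (c := P (b + δ)))
        (fun s hs => hP ⟨hab.le.trans hs.1, by linarith [hs.2]⟩ hbδI hs.2)
      simpa using this
    have hPlb : δ * P a ≤ ∫ s in a..a + δ, P s := by
      have := intervalIntegral.integral_mono_on (show a ≤ a + δ by linarith)
        (intervalIntegrable_const (c := P a)) (hsub hPi le_rfl (by linarith) (by linarith))
        (fun s hs => hP haI ⟨hs.1, by linarith [hs.2]⟩ hs.1)
      simpa using this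
    have hqb := hsub hq (s := b) (t := b + δ) hab.le (by linarith) (by linarith)
    have h2 : (∫ s in b..b + δ, f s) ≤
        ∫ s in b..b + δ, (δ * q s + (f b + (κ + C * δ) * (P (b + δ) - P b))) := by
      refine integral_le_integral_of_ae_Ioo (by linarith)
        (hsub hf hab.le (by linarith) (by linarith))
        ((hqb.const_mul _).add intervalIntegrable_const) ?_
      filter_upwards [h] with s hs hsI
      have hle := hs ⟨hab.trans hsI.1, by linarith [hsI.2]⟩ b hbI
      have hsI' : s ∈ Icc a (b + 1) := ⟨hab.le.trans hsI.1.le, by linarith [hsI.2]⟩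
      have hP1 : P b ≤ P s := hP hbI hsI' hsI.1.le
      have hP2 : P s ≤ P (b + δ) := hP hsI' hbδI hsI.2.le
      rw [abs_of_nonpos (sub_nonpos.2 hsI.1.le), abs_of_nonpos (sub_nonpos.2 hP1)] at hle
      have e1 : -(b - s) * q s ≤ δ * q s :=
        mul_le_mul_of_nonneg_right (by linarith [hsI.2]) (hq0 s)
      have e2 : (κ + C * -(b - s)) * -(P b - P s) ≤ (κ + C * δ) * (P (b + δ) - P b) := by
        refine mul_le_mul ?_ (by linarith) (by linarith) hκδ
        have := mul_le_mul_of_nonneg_left (show -(b - s) ≤ δ by linarith [hsI.2]) hC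
        linarith
      linarith
    rw [intervalIntegral.integral_add (hqb.const_mul _) intervalIntegrable_const,
      intervalIntegral.integral_const_mul, intervalIntegral.integral_const, smul_eq_mul,
      add_sub_cancel_left] at h2
    have h3 : (κ + C * δ) * ((∫ s in b..b + δ, P s) - ∫ s in a..a + δ, P s) ≤
        (κ + C * δ) * (δ * P (b + δ) - δ * P a) :=
      mul_le_mul_of_nonneg_left (by linarith) hκδ
    linarith
  have hadd := tendsto_add_nhdsGT b
  have hqlim : Tendsto (fun δ : ℝ => ∫ s in b..b + δ, q s) (𝓝[>] 0) (𝓝 0) := by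
    have hcont := (hq.absolutelyContinuousOnInterval_intervalIntegral (c := b)
      (by rw [uIcc_of_le (by linarith)]; exact ⟨hab.le, by linarith⟩)).continuousOn
    rw [uIcc_of_le (by linarith)] at hcont
    have h1 := (hcont b ⟨hab.le, by linarith⟩).mono_left (nhdsWithin_le_of_mem (t := Ioi b)
      (by filter_upwards [Ioo_mem_nhdsGT (show b < b + 1 by linarith)] with s hs
          exact ⟨hab.le.trans hs.1.le, hs.2.le⟩))
    simp only [intervalIntegral.integral_same] at h1
    exact h1.comp hadd
  have hPlim := hPb.comp hadd
  have hκlim : Tendsto (fun δ : ℝ => κ + C * δ) (𝓝[>] 0) (𝓝 (κ + C * 0)) :=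
    (Continuous.tendsto (by fun_prop) 0).mono_left nhdsWithin_le_nhds
  have hlim := ((tendsto_const_nhds (x := ∫ s in a..b, q s)).add hqlim).add
    (hκlim.mul ((hPlim.sub_const (P a)).add (hPlim.sub_const (P b)))) |>.const_add (f b)
  suffices hc : ∀ c < f a, c ≤ f b + ((∫ s in a..b, q s) + κ * (P b - P a)) by
    have := le_of_forall_lt_imp_le_of_dense hc
    linarith
  intro c hc
  have hle := ge_of_tendsto hlim (b := c) ?_
  · simpa using hle
  obtain ⟨δ₀, hδ₀, hcf⟩ := mem_nhdsGT_iff_exists_Ioo_subset.1 (hfa c hc)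
  have hδ₀' : 0 < δ₀ - a := sub_pos.2 hδ₀
  filter_upwards [Ioo_mem_nhdsGT (lt_min one_pos hδ₀')] with δ hδ
  have hδ1 := hδ.2.trans_le (min_le_left _ _)
  have hδ2 := hδ.2.trans_le (min_le_right _ _)
  have hk := key δ ⟨hδ.1, hδ1⟩
  have hlow : δ * c ≤ ∫ s in a..a + δ, f s := by
    have := intervalIntegral.integral_mono_on_of_le_Ioo (show a ≤ a + δ by linarith [hδ.1])
      (intervalIntegrable_const (c := c)) (hsub hf le_rfl (by linarith [hδ.1]) (by linarith))
      (fun s hs => (hcf ⟨hs.1, by linarith [hs.2]⟩ : c < f s).le)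
    simpa using this
  exact le_of_mul_le_mul_left (hlow.trans hk) hδ.1

/-! ### Solutions are curves of maximal slope -/

lemma neg_mul_le_half_sq_sub_half_sq {a b e : ℝ} (ha : 0 ≤ a) (h : a ≤ b + e) :
    -(e * a) ≤ b ^ 2 / 2 - a ^ 2 / 2 := by
  rcases le_total e a with hle | hle
  · nlinarith [pow_le_pow_left₀ (sub_nonneg.2 hle) (sub_le_iff_le_add.2 h) 2, sq_nonneg e]
  · nlinarith [mul_le_mul_of_nonneg_right hle ha, sq_nonneg b]

/-- A bound `r` for the right speed of a solution bounds the slope, and this globally: the EVI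
compares the energy gap to `y` with the rate at which the distance to `y` can decrease. -/
lemma IsEVISolution.sub_le_speed_mul_dist (hφ : IsProperLSC φ) (hu : IsEVISolution φ lam u) {t : ℝ}
    (ht : 0 < t) {r : ℝ} (h : ∃ᶠ z in 𝓝[>] t, dist (u z) (u t) ≤ r * (z - t)) {y : X}
    (hy : y ∈ Dom φ) :
    (φ (u t)).toReal - (φ y).toReal ≤ r * dist (u t) y - lam / 2 * dist (u t) y ^ 2 := by
  by_contra hcon
  have hev := hu.eventually_slope_lt hφ ht hy (r := -(r * dist (u t) y)) (by linarith)
  obtain ⟨z, hz1, hz2, hz3⟩ := (h.and_eventually (hev.and self_mem_nhdsWithin)).exists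
  have hzt : 0 < z - t := sub_pos.2 hz3
  rw [slope_def_field, div_lt_iff₀ hzt] at hz2
  have htri := dist_triangle_left (u t) y (u z)
  have := neg_mul_le_half_sq_sub_half_sq (a := dist (u t) y) (b := dist (u z) y)
    (e := r * (z - t)) dist_nonneg (by linarith)
  linarith

lemma IsEVISolution.slope_le_ofReal (hφ : IsProperLSC φ) (hu : IsEVISolution φ lam u) {t : ℝ}
    (ht : 0 < t) {r : ℝ} (hr : 0 ≤ r) (h : ∃ᶠ z in 𝓝[>] t, dist (u z) (u t) ≤ r * (z - t)) :
    slope φ (u t) ≤ ENNReal.ofReal r :=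
  hφ.slope_le_of_forall (hu.mem_dom t ht) hr (C := -(lam / 2)) fun y hy => by
    linarith [hu.sub_le_speed_mul_dist hφ ht h hy]

lemma IsProperLSC.eventually_lt_energy (hφ : IsProperLSC φ) (hc : ContinuousOn u (Ici 0))
    (hD : ∀ t, 0 ≤ t → u t ∈ Dom φ) {a : ℝ} (ha : 0 ≤ a) {c : ℝ} (h : c < (φ (u a)).toReal) :
    ∀ᶠ s in 𝓝[>] a, c < (φ (u s)).toReal := by
  have hlim : Tendsto u (𝓝[>] a) (𝓝 (u a)) :=
    (hc a ha).mono_left (nhdsWithin_mono _ fun x hx => ha.trans (le_of_lt hx))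
  filter_upwards [hlim.eventually (hφ.eventually_lt_toReal (hD a ha) h), self_mem_nhdsWithin]
    with s hs has using hs (hD s (ha.trans (le_of_lt has)))

lemma IsEVISolution.tendsto_energy (hφ : IsProperLSC φ) (hu : IsEVISolution φ lam u)
    (hc : ContinuousOn u (Ici 0)) (h0 : u 0 ∈ Dom φ) {b : ℝ} (hb : 0 ≤ b) :
    Tendsto (fun t => (φ (u t)).toReal) (𝓝[>] b) (𝓝 (φ (u b)).toReal) := by
  refine tendsto_order.2 ⟨fun c h => ?_, fun c h => ?_⟩
  · exact hφ.eventually_lt_energy hc (fun t ht => hu.mem_dom' h0 ht) hb h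
  · filter_upwards [self_mem_nhdsWithin] with s hs
    exact lt_of_le_of_lt (hu.antitoneOn_energy hφ hc h0 hb (hb.trans (le_of_lt hs)) (le_of_lt hs)) h

/-- Where the energy is differentiable, the square of the right speed of a solution does not exceed
the rate of energy dissipation. -/
lemma IsEVISolution.eventually_dist_le_of_hasDerivAt (hφ : IsProperLSC φ)
    (hu : IsEVISolution φ lam u) (hc : ContinuousOn u (Ici 0)) (h0 : u 0 ∈ Dom φ) {t f' r : ℝ}
    (ht : 0 < t) (hf : HasDerivAt (fun s => (φ (u s)).toReal) f' t) (hr : 0 ≤ r)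
    (hfr : -f' < r ^ 2) : ∀ᶠ z in 𝓝[>] t, dist (u z) (u t) ≤ r * (z - t) := by
  set f : ℝ → ℝ := fun s => (φ (u s)).toReal with hfdef
  have hanti := hu.antitoneOn_energy hφ hc h0
  obtain ⟨κ, hκ1, hκ2⟩ := exists_between hfr
  set C := 2 * Real.exp (|lam| * (t + 1)) with hCdef
  have hslope : ∀ᶠ z in 𝓝[>] t, f t - f z ≤ κ * (z - t) := by
    have h1 := tendsto_slope_nhdsGT hf
    filter_upwards [h1.eventually (lt_mem_nhds (show -κ < f' by linarith)), self_mem_nhdsWithin]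
      with z hz hzt
    have hzt' : 0 < z - t := sub_pos.2 hzt
    rw [slope_def_field, lt_div_iff₀ hzt'] at hz
    linarith
  have hsmall : ∀ᶠ z in 𝓝[>] t, κ + |lam| / 2 * C * κ * (z - t) < r ^ 2 := by
    have : Tendsto (fun z => κ + |lam| / 2 * C * κ * (z - t)) (𝓝 t)
        (𝓝 (κ + |lam| / 2 * C * κ * (t - t))) := Continuous.tendsto (by fun_prop) t
    rw [sub_self, mul_zero, add_zero] at this
    exact (this.eventually (gt_mem_nhds hκ2)).filter_mono nhdsWithin_le_nhds
  obtain ⟨b, hb, hev⟩ := mem_nhdsGT_iff_exists_Ioo_subset.1 (hslope.and hsmall)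
  filter_upwards [Ioo_mem_nhdsGT (lt_min hb (lt_add_one t))] with z hz
  have hzb := hz.2.trans_le (min_le_left _ _)
  have hz1 := hz.2.trans_le (min_le_right _ _)
  -- The EVI tested with `u t` bounds the derivative of half the squared distance by the energy
  -- drop, at most `κ * (s - t)`, up to the term in `λ`, which the quadratic bound makes of higher order.
  have hcomp := sub_le_sub_of_eventually_slope_lt (f := fun s => dist (u s) (u t) ^ 2 / 2)
    (B := fun s => r ^ 2 * ((s - t) ^ 2 / 2)) (B' := fun s => r ^ 2 * (s - t)) hz.1.le
    ((continuousOn_half_sq_dist hc continuousOn_const).mono fun s hs => ht.le.trans hs.1)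
    (by fun_prop)
    (fun x _ => by
      have := ((((hasDerivAt_id x).sub_const t).pow 2).div_const 2).const_mul (r ^ 2)
      refine this.congr_deriv ?_
      simp) ?_
  · have h1 : dist (u z) (u t) ^ 2 ≤ (r * (z - t)) ^ 2 := by
      simp only [dist_self, sub_self] at hcomp
      rw [mul_pow]
      linarith
    exact le_of_sq_le_sq h1 (mul_nonneg hr (sub_nonneg.2 hz.1.le))
  · intro s hs q hq
    have hs0 : 0 < s := ht.trans hs.1
    have hst : 0 < s - t := sub_pos.2 hs.1
    refine hu.eventually_slope_lt hφ hs0 (hu.mem_dom t ht) (lt_of_le_of_lt ?_ hq)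
    obtain ⟨e1, e2⟩ := hev ⟨hs.1, hs.2.trans hzb⟩
    have hE : 0 ≤ f t - f s := sub_nonneg.2 (hanti ht.le hs0.le hs.1.le)
    have hd := hu.sq_dist_le hφ hc h0 ht.le hs.1.le
    have hexp : 2 * Real.exp (|lam| * s) ≤ C := by
      rw [hCdef]
      gcongr
      linarith [hs.2]
    have hd2 : dist (u s) (u t) ^ 2 ≤ C * ((s - t) * (κ * (s - t))) := by
      rw [dist_comm]
      refine hd.trans (mul_le_mul hexp (mul_le_mul_of_nonneg_left e1 hst.le)
        (mul_nonneg hst.le hE) (le_trans (by positivity) hexp))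
    have h3 := mul_le_mul_of_nonneg_right (neg_abs_le lam) (sq_nonneg (dist (u s) (u t)))
    have h4 := mul_le_mul_of_nonneg_left hd2 (abs_nonneg lam)
    have h5 := mul_lt_mul_of_pos_right e2 hst
    simp only [hfdef] at e1
    linarith

lemma le_half_add_of_sq_le_mul {d x y : ℝ} (hx : 0 ≤ x) (hy : 0 ≤ y) (h : d ^ 2 ≤ x * y) :
    d ≤ (x + y) / 2 :=
  le_of_sq_le_sq (by nlinarith [sq_nonneg (x - y)]) (by positivity)

/-- The energy of a solution is absolutely continuous. The quadratic bound on distances in terms of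
the energy turns the slope inequality into a difference inequality for the energy alone, in which
half of the energy drop is absorbed. -/
lemma IsEVISolution.energy_sub_le_integral (hφ : IsProperLSC φ) (hu : IsEVISolution φ lam u)
    (hc : ContinuousOn u (Ici 0)) (h0 : u 0 ∈ Dom φ) {a b T : ℝ} (ha : 0 ≤ a) (hab : a < b)
    (hbT : b ≤ T) : (φ (u a)).toReal - (φ (u b)).toReal ≤
      ∫ s in a..b, 2 * Real.exp (|lam| * (T + 1)) * |deriv (fun s => (φ (u s)).toReal) s| := by
  set f : ℝ → ℝ := fun s => (φ (u s)).toReal with hfdef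
  have hanti := hu.antitoneOn_energy hφ hc h0
  set C := 2 * Real.exp (|lam| * (T + 1)) with hCdef
  have hC0 : 0 < C := by positivity
  have hab1 : a ≤ b + 1 := by linarith
  have hsub : Icc a (b + 1) ⊆ Ici 0 := fun x hx => ha.trans hx.1
  have hantiI : AntitoneOn f (uIcc a (b + 1)) := by
    rw [uIcc_of_le hab1]
    exact hanti.mono hsub
  have hmono : MonotoneOn (fun s => -f s) (uIcc a (b + 1)) := hantiI.neg
  have hderiv : IntervalIntegrable (deriv f) volume a (b + 1) := by
    simpa [Pi.neg_def] using hmono.intervalIntegrable_deriv.neg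
  have hdist : ∀ s ∈ Icc a (b + 1), ∀ t ∈ Icc a (b + 1),
      dist (u s) (u t) ^ 2 ≤ C * |t - s| * |f s - f t| := by
    have key : ∀ s ∈ Icc a (b + 1), ∀ t ∈ Icc a (b + 1), s ≤ t →
        dist (u s) (u t) ^ 2 ≤ C * |t - s| * |f s - f t| := by
      intro s hs t ht hst
      have hE : 0 ≤ f s - f t := sub_nonneg.2 (hanti (hsub hs) (hsub ht) hst)
      rw [abs_of_nonneg (sub_nonneg.2 hst), abs_of_nonneg hE, mul_assoc]
      refine (hu.sq_dist_le hφ hc h0 (hsub hs) hst).trans ?_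
      refine mul_le_mul_of_nonneg_right ?_ (mul_nonneg (sub_nonneg.2 hst) hE)
      rw [hCdef]
      gcongr
      linarith [ht.2]
    intro s hs t ht
    rcases le_total s t with h | h
    · exact key s hs t ht h
    · rw [dist_comm, abs_sub_comm t, abs_sub_comm (f s)]
      exact key t ht s hs h
  -- with `P = -f` and `κ = 1 / 2` the last term is half of the left-hand side
  have hmain := sub_le_integral_add_of_ae_sub_le (f := f) (P := fun s => -f s)
    (q := fun s => C / 2 * |deriv f s|) (a := a) (b := b) (κ := 1 / 2) (C := |lam| / 2 * C) hab
    (by norm_num) (by positivity) hantiI.intervalIntegrable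
    (by rwa [uIcc_of_le hab1] at hmono) (hu.tendsto_energy hφ hc h0 (ha.trans hab.le)).neg
    (hderiv.abs.const_mul _) (fun s => by positivity)
    (fun c hc' => hφ.eventually_lt_energy hc (fun t ht => hu.mem_dom' h0 ht) ha hc') ?_
  · rw [intervalIntegral.integral_const_mul] at hmain ⊢
    linarith
  have hdiff : ∀ᵐ s, s ∈ Icc a (b + 1) →
      DifferentiableWithinAt ℝ (fun s => -f s) (Icc a (b + 1)) s := by
    rw [uIcc_of_le hab1] at hmono
    exact hmono.ae_differentiableWithinAt_of_mem
  filter_upwards [hdiff] with s hs hsI t ht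
  have hs0 : 0 < s := ha.trans_lt hsI.1
  have hsI' := Ioo_subset_Icc_self hsI
  have hds : DifferentiableAt ℝ f s := by
    have := ((hs hsI').differentiableAt (Icc_mem_nhds hsI.1 hsI.2)).neg
    simpa using this
  set G := Real.sqrt |deriv f s| with hG
  have hG0 : 0 ≤ G := Real.sqrt_nonneg _
  have hG2 : G ^ 2 = |deriv f s| := Real.sq_sqrt (abs_nonneg _)
  have hle : f s - f t ≤ G * dist (u s) (u t) - lam / 2 * dist (u s) (u t) ^ 2 := by
    refine le_of_forall_pos_le_add fun ε hε => ?_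
    have hd0 := dist_nonneg (x := u s) (y := u t)
    have hη : 0 < ε / (dist (u s) (u t) + 1) := by positivity
    have hr : -deriv f s < (G + ε / (dist (u s) (u t) + 1)) ^ 2 := by
      have h1 := neg_le_abs (deriv f s)
      nlinarith [mul_nonneg hG0 hη.le, mul_pos hη hη]
    have h := hu.sub_le_speed_mul_dist hφ hs0
      (hu.eventually_dist_le_of_hasDerivAt hφ hc h0 hs0 hds.hasDerivAt (by positivity)
        hr).frequently (hu.mem_dom' h0 (hsub ht))
    have e : ε / (dist (u s) (u t) + 1) * (dist (u s) (u t) + 1) = ε := by field_simp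
    simp only [hfdef]
    linarith
  have hd := hdist s hsI' t ht
  have hyoung : G * dist (u s) (u t) ≤ (C * |t - s| * G ^ 2 + |f s - f t|) / 2 := by
    refine le_half_add_of_sq_le_mul (by positivity) (abs_nonneg _) ?_
    rw [mul_pow]
    calc G ^ 2 * dist (u s) (u t) ^ 2 ≤ G ^ 2 * (C * |t - s| * |f s - f t|) := by gcongr
      _ = C * |t - s| * G ^ 2 * |f s - f t| := by ring
  have h3 := mul_le_mul_of_nonneg_right (neg_abs_le lam) (sq_nonneg (dist (u s) (u t)))
  have h4 := mul_le_mul_of_nonneg_left hd (abs_nonneg lam)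
  rw [hG2] at hyoung
  have e : |(-f t) - (-f s)| = |f s - f t| := by congr 1; ring
  rw [e]
  linarith

lemma IsEVISolution.energy_absolutelyContinuous (hφ : IsProperLSC φ) (hu : IsEVISolution φ lam u)
    (hc : ContinuousOn u (Ici 0)) (h0 : u 0 ∈ Dom φ) {T : ℝ} (hT : 0 ≤ T) :
    AbsolutelyContinuousOnInterval (fun t => (φ (u t)).toReal) 0 T := by
  set f : ℝ → ℝ := fun s => (φ (u s)).toReal with hfdef
  have hanti := hu.antitoneOn_energy hφ hc h0
  have hmono : MonotoneOn (fun s => -f s) (uIcc 0 T) := by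
    rw [uIcc_of_le hT]
    exact (hanti.mono fun x hx => hx.1).neg
  have hderiv : IntervalIntegrable (deriv f) volume 0 T := by
    simpa [Pi.neg_def] using hmono.intervalIntegrable_deriv.neg
  have hint := hderiv.abs.const_mul (2 * Real.exp (|lam| * (T + 1)))
  refine absolutelyContinuousOnInterval_of_dist_le
    (hint.absolutelyContinuousOnInterval_intervalIntegral (c := 0) left_mem_uIcc) ?_
  rw [uIcc_of_le hT]
  have hsub : ∀ t ∈ Icc 0 T, IntervalIntegrable
      (fun s => 2 * Real.exp (|lam| * (T + 1)) * |deriv f s|) volume 0 t := fun t ht =>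
    hint.mono_set (by rw [uIcc_of_le hT, uIcc_of_le ht.1]; exact Icc_subset_Icc_right ht.2)
  have key : ∀ s ∈ Icc 0 T, ∀ t ∈ Icc 0 T, s ≤ t → dist (f s) (f t) ≤
      dist (∫ r in 0..s, 2 * Real.exp (|lam| * (T + 1)) * |deriv f r|)
        (∫ r in 0..t, 2 * Real.exp (|lam| * (T + 1)) * |deriv f r|) := by
    intro s hs t ht hst
    rcases hst.eq_or_lt with rfl | hst
    · simp
    rw [dist_comm (∫ r in 0..s, _), Real.dist_eq (∫ r in 0..t, _),
      intervalIntegral.integral_interval_sub_left (hsub t ht) (hsub s hs), Real.dist_eq,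
      abs_of_nonneg (sub_nonneg.2 (hanti hs.1 ht.1 hst.le))]
    exact (hu.energy_sub_le_integral hφ hc h0 hs.1 hst ht.2).trans (le_abs_self _)
  intro s hs t ht
  rcases le_total s t with h | h
  · exact key s hs t ht h
  · rw [dist_comm, dist_comm (∫ r in 0..s, _)]
    exact key t ht s hs h

lemma IsEVISolution.ae_differentiableAt_energy (hφ : IsProperLSC φ) (hu : IsEVISolution φ lam u)
    (hc : ContinuousOn u (Ici 0)) (h0 : u 0 ∈ Dom φ) :
    ∀ᵐ t, 0 < t → DifferentiableAt ℝ (fun t => (φ (u t)).toReal) t := by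
  have h : ∀ n : ℕ, ∀ᵐ t, t ∈ uIcc 0 (n : ℝ) → DifferentiableAt ℝ (fun t => (φ (u t)).toReal) t :=
    fun n => (hu.energy_absolutelyContinuous hφ hc h0 n.cast_nonneg).ae_differentiableAt
  filter_upwards [ae_all_iff.2 h] with t ht ht0
  obtain ⟨n, hn⟩ := exists_nat_ge t
  refine ht n ?_
  rw [uIcc_of_le n.cast_nonneg]
  exact ⟨ht0.le, hn⟩

lemma IsEVISolution.memLp_sqrt_abs_deriv_energy (hφ : IsProperLSC φ) (hu : IsEVISolution φ lam u)
    (hc : ContinuousOn u (Ici 0)) (h0 : u 0 ∈ Dom φ) {a b : ℝ} (ha : 0 ≤ a) (hab : a ≤ b) :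
    MemLp (fun s => Real.sqrt |deriv (fun s => (φ (u s)).toReal) s|) 2
      (volume.restrict (Icc a b)) := by
  have hderiv := (hu.energy_absolutelyContinuous hφ hc h0 (ha.trans hab)).intervalIntegrable_deriv
  rw [intervalIntegrable_iff_integrableOn_Icc_of_le (ha.trans hab)] at hderiv
  have hmeas : Measurable fun s => Real.sqrt |deriv (fun s => (φ (u s)).toReal) s| := by
    have := measurable_deriv (fun s => (φ (u s)).toReal)
    fun_prop
  refine (memLp_two_iff_integrable_sq hmeas.aestronglyMeasurable).2 ?_
  simp only [Real.sq_sqrt (abs_nonneg _)]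
  exact (hderiv.mono_set (Icc_subset_Icc_left ha)).abs

/-- The square root of the dissipation rate is an admissible density. The increments of the curve
are dominated by those of the absolutely continuous function `C / 2 * s - f s / 2`, where `f` is
the energy. -/
lemma IsEVISolution.dist_le_integral (hφ : IsProperLSC φ) (hu : IsEVISolution φ lam u)
    (hc : ContinuousOn u (Ici 0)) (h0 : u 0 ∈ Dom φ) {a b : ℝ} (ha : 0 ≤ a) (hab : a ≤ b) :
    dist (u a) (u b) ≤ ∫ s in a..b, Real.sqrt |deriv (fun s => (φ (u s)).toReal) s| := by
  set f : ℝ → ℝ := fun s => (φ (u s)).toReal with hfdef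
  have hanti := hu.antitoneOn_energy hφ hc h0
  set C := 2 * Real.exp (|lam| * b) with hCdef
  have hC0 : 0 < C := by positivity
  have hsub : Icc a b ⊆ Ici 0 := fun x hx => ha.trans hx.1
  have hac : AbsolutelyContinuousOnInterval (fun s => C / 2 * s - 1 / 2 * f s) a b := by
    have h1 : AbsolutelyContinuousOnInterval (fun s : ℝ => C / 2 * s) a b :=
      (ContDiff.contDiffOn (by fun_prop)).absolutelyContinuousOnInterval
    have h2 := (hu.energy_absolutelyContinuous hφ hc h0 (ha.trans hab)).mono (c := a) (d := b)
      (by rw [uIcc_of_le hab, uIcc_of_le (ha.trans hab)]; exact Icc_subset_Icc_left ha)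
    exact h1.sub (h2.const_mul (1 / 2))
  have hd : ∀ s ∈ Icc a b, ∀ t ∈ Icc a b, s ≤ t → dist (u s) (u t) ≤
      dist (C / 2 * s - 1 / 2 * f s) (C / 2 * t - 1 / 2 * f t) := by
    intro s hs t ht hst
    have hE : 0 ≤ f s - f t := sub_nonneg.2 (hanti (hsub hs) (hsub ht) hst)
    have h1 : dist (u s) (u t) ≤ (C * (t - s) + (f s - f t)) / 2 := by
      refine le_half_add_of_sq_le_mul (mul_nonneg hC0.le (sub_nonneg.2 hst)) hE ?_
      rw [mul_assoc]
      refine (hu.sq_dist_le hφ hc h0 (hsub hs) hst).trans ?_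
      refine mul_le_mul_of_nonneg_right ?_ (mul_nonneg (sub_nonneg.2 hst) hE)
      rw [hCdef]
      gcongr
      exact ht.2
    rw [dist_comm (C / 2 * s - _), Real.dist_eq]
    exact h1.trans (le_trans (le_of_eq (by ring)) (le_abs_self _))
  have hle := ofReal_dist_le_lintegral hab hac (v := u)
    (m := fun s => ENNReal.ofReal (Real.sqrt |deriv f s|)) (fun s hs t ht => by
      rcases le_total s t with h | h
      · exact hd s hs t ht h
      · rw [dist_comm, dist_comm (C / 2 * s - _)]
        exact hd t ht s hs h) ?_
  · have hintI : IntegrableOn (fun s => Real.sqrt |deriv f s|) (Icc a b) :=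
      (hu.memLp_sqrt_abs_deriv_energy hφ hc h0 ha hab).integrable (by norm_num)
    have hint : IntegrableOn (fun s => Real.sqrt |deriv f s|) (Ioc a b) :=
      hintI.mono_set Ioc_subset_Icc_self
    rw [← ofReal_integral_eq_lintegral_ofReal hint (ae_of_all _ fun s => Real.sqrt_nonneg _),
      ENNReal.ofReal_le_ofReal_iff (integral_nonneg fun s => Real.sqrt_nonneg _)] at hle
    rwa [intervalIntegral.integral_of_le hab]
  · filter_upwards [hu.ae_differentiableAt_energy hφ hc h0] with t ht htI r hr
    have ht0 : 0 < t := ha.trans_lt htI.1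
    obtain ⟨hr1, hr2⟩ := ENNReal.ofReal_lt_ofReal_iff'.1 hr
    refine (hu.eventually_dist_le_of_hasDerivAt hφ hc h0 ht0 (ht ht0).hasDerivAt hr2.le
      ?_).frequently
    exact (neg_le_abs _).trans_lt ((Real.sqrt_lt' hr2).1 hr1)

lemma IsEVISolution.locACOn (hφ : IsProperLSC φ) (hu : IsEVISolution φ lam u)
    (hc : ContinuousOn u (Ici 0)) (h0 : u 0 ∈ Dom φ) : LocACOn 2 (Ici 0) u := by
  intro a b hab hI
  have ha : 0 ≤ a := hI (left_mem_Icc.2 hab)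
  exact ⟨_, hu.memLp_sqrt_abs_deriv_energy hφ hc h0 ha hab, fun s hs t ht hst =>
    hu.dist_le_integral hφ hc h0 (ha.trans hs.1) hst⟩

/-- The two-sided metric derivative is bounded through Lebesgue's differentiation theorem; the EVI
itself only controls the right speed. -/
lemma IsEVISolution.ae_metricDeriv_le (hφ : IsProperLSC φ) (hu : IsEVISolution φ lam u)
    (hc : ContinuousOn u (Ici 0)) (h0 : u 0 ∈ Dom φ) :
    ∀ᵐ t, 0 < t → metricDeriv u t ≤
      ENNReal.ofReal (Real.sqrt |deriv (fun s => (φ (u s)).toReal) t|) := by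
  set m : ℝ → ℝ := fun t => Real.sqrt |deriv (fun s => (φ (u s)).toReal) t| with hm
  have hint : ∀ a b, 0 ≤ a → a ≤ b → IntervalIntegrable m volume a b := fun a b ha hab => by
    rw [intervalIntegrable_iff_integrableOn_Icc_of_le hab]
    exact (hu.memLp_sqrt_abs_deriv_energy hφ hc h0 ha hab).integrable (by norm_num)
  have h : ∀ n : ℕ, ∀ᵐ t, t ∈ uIcc 0 (n : ℝ) → ∀ c ∈ uIcc 0 (n : ℝ),
      HasDerivAt (fun x => ∫ s in c..x, m s) (m t) t :=
    fun n => (hint 0 n le_rfl n.cast_nonneg).ae_hasDerivAt_integral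
  filter_upwards [ae_all_iff.2 h] with t ht ht0
  obtain ⟨n, hn⟩ := exists_nat_ge t
  have htI : t ∈ uIcc 0 (n : ℝ) := by
    rw [uIcc_of_le n.cast_nonneg]
    exact ⟨ht0.le, hn⟩
  have hder := ht n htI t htI
  refine le_of_forall_gt fun c hc' => ?_
  obtain ⟨b', hb1, hb2⟩ := exists_between hc'
  obtain ⟨r, rfl⟩ : ∃ r : ℝ, b' = ENNReal.ofReal r :=
    ⟨b'.toReal, (ENNReal.ofReal_toReal (ne_top_of_lt hb2)).symm⟩
  have hr := (ENNReal.ofReal_lt_ofReal_iff'.1 hb1).1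
  refine lt_of_le_of_lt (metricDeriv_le_ofReal ?_) hb2
  have hm0 : 0 ≤ m t := Real.sqrt_nonneg _
  have hslope := (hasDerivAt_iff_tendsto_slope.1 hder).norm
  rw [Real.norm_of_nonneg hm0] at hslope
  filter_upwards [hslope.eventually (gt_mem_nhds hr), self_mem_nhdsWithin,
    mem_nhdsWithin_of_mem_nhds (Ioi_mem_nhds ht0)] with z hz hzt hz0
  have hzt' : 0 < |z - t| := abs_pos.2 (sub_ne_zero.2 hzt)
  rw [slope_def_field, intervalIntegral.integral_same, sub_zero, norm_div, Real.norm_eq_abs,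
    Real.norm_eq_abs, div_lt_iff₀ hzt'] at hz
  refine le_trans ?_ hz.le
  rcases le_total t z with hle | hle
  · rw [dist_comm]
    exact (hu.dist_le_integral hφ hc h0 ht0.le hle).trans (le_abs_self _)
  · rw [intervalIntegral.integral_symm, abs_neg]
    exact (hu.dist_le_integral hφ hc h0 (le_of_lt hz0) hle).trans (le_abs_self _)

/-- A solution which is continuous up to time `0` and starts in the domain is a curve of maximal
slope. Both the metric derivative and the slope are almost everywhere at most the square root of
the dissipation rate. -/
lemma IsEVISolution.isCurveOfMaximalSlope (hφ : IsProperLSC φ) (hu : IsEVISolution φ lam u)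
    (hc : ContinuousOn u (Ici 0)) (h0 : u 0 ∈ Dom φ) : IsCurveOfMaximalSlope φ u where
  ac := hu.locACOn hφ hc h0
  mem_dom t ht := hu.mem_dom' h0 ht
  energy_ac T hT := hu.energy_absolutelyContinuous hφ hc h0 hT.le
  deriv_le := by
    rw [ae_restrict_iff' measurableSet_Ioi]
    filter_upwards [hu.ae_metricDeriv_le hφ hc h0, hu.ae_differentiableAt_energy hφ hc h0]
      with t hm hd ht
    specialize hm ht
    specialize hd ht
    set f : ℝ → ℝ := fun s => (φ (u s)).toReal with hfdef
    set G := Real.sqrt |deriv f t| with hG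
    have hG0 : 0 ≤ G := Real.sqrt_nonneg _
    have hG2 : G ^ 2 = |deriv f t| := Real.sq_sqrt (abs_nonneg _)
    have hneg : deriv f t ≤ 0 := by
      have hlim := tendsto_slope_nhdsGT hd.hasDerivAt
      refine le_of_tendsto hlim ?_
      filter_upwards [self_mem_nhdsWithin] with z hz
      rw [slope_def_field]
      exact div_nonpos_of_nonpos_of_nonneg (sub_nonpos.2 (hu.antitoneOn_energy hφ hc h0
        (mem_Ici.2 (le_of_lt ht)) (mem_Ici.2 (le_trans (le_of_lt ht) (le_of_lt hz))) (le_of_lt hz)))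
        (sub_nonneg.2 (le_of_lt hz))
    have hslope : slope φ (u t) ≤ ENNReal.ofReal G := by
      refine ENNReal.le_of_forall_pos_le_add fun ε hε _ => ?_
      rw [← ENNReal.ofReal_coe_nnreal, ← ENNReal.ofReal_add hG0 ε.coe_nonneg]
      have hε' : (0 : ℝ) < ε := hε
      refine hu.slope_le_ofReal hφ ht (by positivity) (hu.eventually_dist_le_of_hasDerivAt hφ hc h0
        ht hd.hasDerivAt (by positivity) ?_).frequently
      have := neg_le_abs (deriv f t)
      nlinarith [mul_nonneg hG0 hε'.le, mul_pos hε' hε']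
    have hdis : dissipation φ u t ≤ ENNReal.ofReal (-deriv f t) := by
      have h1 : dissipation φ u t ≤ ENNReal.ofReal G ^ 2 / 2 + ENNReal.ofReal G ^ 2 / 2 :=
        add_le_add (ENNReal.div_le_div_right (pow_le_pow_left₀ bot_le hm 2) 2)
          (ENNReal.div_le_div_right (pow_le_pow_left₀ bot_le hslope 2) 2)
      rwa [ENNReal.add_halves, ← ENNReal.ofReal_pow hG0, hG2, abs_of_nonpos hneg] at h1
    refine EReal.le_neg_of_le_neg ?_
    refine (EReal.coe_ennreal_le_coe_ennreal_iff.2 hdis).trans ?_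
    rw [EReal.coe_ennreal_ofReal, max_eq_left (by linarith)]
    simp

/-! ### The energy dissipation inequality and uniqueness -/

lemma IsEVIGradientFlow.continuousOn_orbit (hS : IsEVIGradientFlow φ lam D S) {x : X}
    (hx : x ∈ D) : ContinuousOn (fun t => S t x) (Ici 0) := by
  intro t ht
  rcases (mem_Ici.1 ht).eq_or_lt with rfl | ht
  · rw [← Ioi_insert]
    refine ContinuousWithinAt.insert ?_
    rw [ContinuousWithinAt, hS.zero x hx]
    exact hS.tendsto_zero x hx
  · exact ((hS.evi x hx).continuousOn.continuousAt (Ioi_mem_nhds ht)).continuousWithinAt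

/-- At every point of the set in which a flow exists the slope controls the energy globally. -/
lemma IsEVIGradientFlow.sub_le_slope_mul_dist (hφ : IsProperLSC φ)
    (hS : IsEVIGradientFlow φ lam D S) {x y : X} (hx : x ∈ D) (hxD : x ∈ Dom φ)
    (hslope : slope φ x ≠ ⊤) (hy : y ∈ Dom φ) : (φ x).toReal - (φ y).toReal ≤
      (slope φ x).toReal * dist x y - lam / 2 * dist x y ^ 2 := by
  have h0 := hS.zero x hx
  have := (hS.evi x hx).sub_le_slope_mul_dist hφ (hS.continuousOn_orbit hx) (by rwa [h0])
    (by rwa [h0]) hy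
  rwa [h0] at this

lemma IsEVIGradientFlow.aemeasurable_slope (hφ : IsProperLSC φ)
    (hS : IsEVIGradientFlow φ lam D S) (hv : ContinuousOn v (Ici 0)) (hvD : ∀ t, 0 ≤ t → v t ∈ D)
    (hvDom : ∀ t, 0 ≤ t → v t ∈ Dom φ) :
    AEMeasurable (fun t => slope φ (v t)) (volume.restrict (Ioi 0)) := by
  have hc : Continuous fun t => v (max 0 t) :=
    hv.comp_continuous (by fun_prop) fun t => mem_Ici.2 (le_max_left _ _)
  have hlsc : LowerSemicontinuousOn (slope φ) (D ∩ Dom φ) :=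
    hφ.lowerSemicontinuousOn_slope inter_subset_right fun x hx hxs y hy =>
      hS.sub_le_slope_mul_dist hφ hx.1 hx.2 hxs hy
  have hcomp : LowerSemicontinuous fun t => slope φ (v (max 0 t)) := by
    rw [← lowerSemicontinuousOn_univ_iff]
    exact hlsc.comp hc.continuousOn fun t _ =>
      ⟨hvD _ (le_max_left _ _), hvDom _ (le_max_left _ _)⟩
  refine ⟨_, hcomp.measurable, ?_⟩
  filter_upwards [ae_restrict_mem measurableSet_Ioi] with t ht
  rw [max_eq_right (le_of_lt ht)]

/-- Since `φ` never takes the value `⊥`, the energy dissipation inequality at time `t` keeps the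
curve in the domain and the dissipation finite. -/
lemma SatisfiesEDI.mem_dom_and_lintegral_le (hφ : IsProperLSC φ) (hv : SatisfiesEDI φ v) {t : ℝ}
    (ht : 0 < t) : v t ∈ Dom φ ∧ ∫⁻ r in Ioc 0 t, dissipation φ v r ≤
      ENNReal.ofReal ((φ (v 0)).toReal - (φ (v t)).toReal) := by
  have h := hv.edi t ht
  set I := ∫⁻ r in Ioc 0 t, dissipation φ v r
  have hI0 : (I : EReal) ≠ ⊥ := EReal.coe_ennreal_ne_bot I
  have hlt : (I : EReal) + φ (v t) < ⊤ := h.trans_lt hv.mem_dom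
  have hdom : v t ∈ Dom φ := by
    change φ (v t) < ⊤
    refine lt_top_iff_ne_top.2 fun htop => ?_
    rw [htop, EReal.add_top_of_ne_bot hI0] at hlt
    exact hlt.ne rfl
  have hI : I ≠ ⊤ := by
    intro htop
    rw [htop, EReal.coe_ennreal_top, EReal.top_add_of_ne_bot (hφ.ne_bot _)] at hlt
    exact hlt.ne rfl
  refine ⟨hdom, ?_⟩
  rw [← hφ.coe_toReal hdom, ← hφ.coe_toReal hv.mem_dom, ← EReal.coe_ennreal_toReal hI,
    ← EReal.coe_add, EReal.coe_le_coe_iff] at h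
  rw [← ENNReal.ofReal_toReal hI]
  exact ENNReal.ofReal_le_ofReal (by linarith)

lemma SatisfiesEDI.mem_dom' (hφ : IsProperLSC φ) (hv : SatisfiesEDI φ v) {t : ℝ} (ht : 0 ≤ t) :
    v t ∈ Dom φ := by
  rcases ht.eq_or_lt with rfl | ht
  exacts [hv.mem_dom, (hv.mem_dom_and_lintegral_le hφ ht).1]

lemma SatisfiesEDI.intervalIntegrable_energy (hφ : IsProperLSC φ) (hv : SatisfiesEDI φ v) {T : ℝ}
    (hT : 0 ≤ T) : IntervalIntegrable (fun t => (φ (v t)).toReal) volume 0 T := by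
  have hc : Continuous fun t => v (max 0 t) :=
    hv.ac.continuousOn.comp_continuous (by fun_prop) fun t => mem_Ici.2 (le_max_left _ _)
  have hlsc : LowerSemicontinuous fun t => φ (v (max 0 t)) := by
    rw [← lowerSemicontinuousOn_univ_iff]
    exact (hφ.lsc.lowerSemicontinuousOn univ).comp hc.continuousOn (mapsTo_univ _ _)
  obtain ⟨s, hs, hmin⟩ := (hlsc.lowerSemicontinuousOn _).exists_isMinOn
    (nonempty_Icc.2 hT) isCompact_Icc
  rw [intervalIntegrable_iff_integrableOn_Icc_of_le hT]
  have hmeas : AEStronglyMeasurable (fun t => (φ (v t)).toReal) (volume.restrict (Icc 0 T)) := by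
    refine (AEMeasurable.aestronglyMeasurable ⟨_, hlsc.measurable.ereal_toReal, ?_⟩)
    filter_upwards [ae_restrict_mem measurableSet_Icc] with t ht
    rw [max_eq_right ht.1]
  refine Integrable.of_bound hmeas (max (φ (v 0)).toReal (-(φ (v s)).toReal)) ?_
  filter_upwards [ae_restrict_mem measurableSet_Icc] with t ht
  have h1 : (φ (v s)).toReal ≤ (φ (v t)).toReal := by
    rw [hφ.toReal_le_toReal (hv.mem_dom' hφ hs.1) (hv.mem_dom' hφ ht.1)]
    have := hmin ht
    simpa only [mem_ofPred_eq, max_eq_right ht.1, max_eq_right hs.1] using this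
  have h2 : (φ (v t)).toReal ≤ (φ (v 0)).toReal := by
    rcases ht.1.eq_or_lt with rfl | ht0
    · exact le_rfl
    rw [hφ.toReal_le_toReal (hv.mem_dom' hφ ht.1) hv.mem_dom]
    refine le_trans ?_ (hv.edi t ht0)
    exact le_add_of_nonneg_left (EReal.coe_ennreal_nonneg _)
  rw [Real.norm_eq_abs, abs_le]
  exact ⟨by linarith [le_max_right (φ (v 0)).toReal (-(φ (v s)).toReal)],
    h2.trans (le_max_left _ _)⟩

lemma ofReal_toReal_sq {x : ℝ≥0∞} (hx : x ≠ ⊤) : ENNReal.ofReal (x.toReal ^ 2) = x ^ 2 := by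
  rw [ENNReal.ofReal_pow ENNReal.toReal_nonneg, ENNReal.ofReal_toReal hx]

lemma SatisfiesEDI.ae_ne_top (hφ : IsProperLSC φ) (hS : IsEVIGradientFlow φ lam D S)
    (hv : SatisfiesEDI φ v) (hvD : ∀ t, 0 ≤ t → v t ∈ D) :
    ∀ᵐ t, 0 < t → metricDeriv v t ≠ ⊤ ∧ slope φ (v t) ≠ ⊤ := by
  have hm := aemeasurable_metricDeriv hv.ac.continuousOn
  have hg := hS.aemeasurable_slope hφ hv.ac.continuousOn hvD fun t ht => hv.mem_dom' hφ ht
  have hdis : AEMeasurable (dissipation φ v) (volume.restrict (Ioi 0)) :=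
    ((hm.pow_const 2).div_const 2).add ((hg.pow_const 2).div_const 2)
  have h : ∀ n : ℕ, ∀ᵐ t, t ∈ Ioc 0 ((n : ℝ) + 1) → dissipation φ v t < ⊤ := by
    intro n
    rw [← ae_restrict_iff' measurableSet_Ioc]
    refine ae_lt_top' (hdis.mono_measure (Measure.restrict_mono Ioc_subset_Ioi_self le_rfl)) ?_
    exact ne_top_of_le_ne_top ENNReal.ofReal_ne_top
      (hv.mem_dom_and_lintegral_le hφ (by positivity)).2
  filter_upwards [ae_all_iff.2 h] with t ht ht0
  obtain ⟨n, hn⟩ := exists_nat_ge t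
  have hfin := ht n ⟨ht0, by linarith⟩
  refine ⟨fun htop => hfin.ne ?_, fun htop => hfin.ne ?_⟩ <;>
    simp [dissipation, htop, ENNReal.top_div]

lemma SatisfiesEDI.intervalIntegrable_sq (hφ : IsProperLSC φ) (hS : IsEVIGradientFlow φ lam D S)
    (hv : SatisfiesEDI φ v) (hvD : ∀ t, 0 ≤ t → v t ∈ D) {T : ℝ} (hT : 0 < T) :
    IntervalIntegrable (fun t => (metricDeriv v t).toReal ^ 2) volume 0 T ∧
      IntervalIntegrable (fun t => (slope φ (v t)).toReal ^ 2) volume 0 T ∧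
      (∫ t in 0..T, (metricDeriv v t).toReal ^ 2) / 2 +
        (∫ t in 0..T, (slope φ (v t)).toReal ^ 2) / 2 ≤
          (φ (v 0)).toReal - (φ (v T)).toReal := by
  have hmono : volume.restrict (Ioc 0 T) ≤ volume.restrict (Ioi 0) :=
    Measure.restrict_mono Ioc_subset_Ioi_self le_rfl
  have hm := (aemeasurable_metricDeriv hv.ac.continuousOn).mono_measure hmono
  have hg := (hS.aemeasurable_slope hφ hv.ac.continuousOn hvD
    fun t ht => hv.mem_dom' hφ ht).mono_measure hmono
  obtain ⟨-, hle⟩ := hv.mem_dom_and_lintegral_le hφ hT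
  have hsum : ∫⁻ r in Ioc 0 T, dissipation φ v r =
      (∫⁻ t in Ioc 0 T, metricDeriv v t ^ 2) / 2 + (∫⁻ t in Ioc 0 T, slope φ (v t) ^ 2) / 2 := by
    simp only [dissipation, div_eq_mul_inv]
    rw [lintegral_add_left' ((hm.pow_const 2).mul_const _),
      lintegral_mul_const'' _ (hm.pow_const 2),
      lintegral_mul_const'' _ (hg.pow_const 2)]
  rw [hsum] at hle
  have hlt := hle.trans_lt ENNReal.ofReal_lt_top
  have hA : (∫⁻ t in Ioc 0 T, metricDeriv v t ^ 2) ≠ ⊤ := fun h => by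
    simp [h, ENNReal.top_div] at hlt
  have hB : (∫⁻ t in Ioc 0 T, slope φ (v t) ^ 2) ≠ ⊤ := fun h => by
    simp [h, ENNReal.top_div] at hlt
  have key : ∀ {h : ℝ → ℝ≥0∞}, AEMeasurable h (volume.restrict (Ioc 0 T)) →
      (∫⁻ t in Ioc 0 T, h t ^ 2) ≠ ⊤ → IntervalIntegrable (fun t => (h t).toReal ^ 2) volume 0 T ∧
      (∫ t in 0..T, (h t).toReal ^ 2) = (∫⁻ t in Ioc 0 T, h t ^ 2).toReal := by
    intro h hmeas hfin
    simp only [← ENNReal.toReal_pow]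
    rw [intervalIntegrable_iff_integrableOn_Ioc_of_le hT.le, intervalIntegral.integral_of_le hT.le]
    refine ⟨integrable_toReal_of_lintegral_ne_top (hmeas.pow_const 2) hfin, ?_⟩
    exact integral_toReal (hmeas.pow_const 2) (ae_lt_top' (hmeas.pow_const 2) hfin)
  obtain ⟨i1, e1⟩ := key hm hA
  obtain ⟨i2, e2⟩ := key hg hB
  refine ⟨i1, i2, ?_⟩
  rw [e1, e2]
  have h0 : 0 ≤ (φ (v 0)).toReal - (φ (v T)).toReal := by
    rw [sub_nonneg, hφ.toReal_le_toReal (hv.mem_dom' hφ hT.le) hv.mem_dom]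
    exact (le_add_of_nonneg_left (EReal.coe_ennreal_nonneg _)).trans (hv.edi T hT)
  have h1 := ENNReal.toReal_mono ENNReal.ofReal_ne_top hle
  rw [ENNReal.toReal_ofReal h0, ENNReal.toReal_add
    (ENNReal.div_ne_top hA (by norm_num)) (ENNReal.div_ne_top hB (by norm_num)),
    ENNReal.toReal_div, ENNReal.toReal_div] at h1
  simpa using h1

lemma SatisfiesEDI.sq_dist_le_integral (hφ : IsProperLSC φ) (hS : IsEVIGradientFlow φ lam D S)
    (hv : SatisfiesEDI φ v) (hvD : ∀ t, 0 ≤ t → v t ∈ D) {s t : ℝ} (hs : 0 ≤ s) (hst : s ≤ t) :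
    dist (v s) (v t) ^ 2 ≤ (t - s) * ∫ r in s..t, (metricDeriv v r).toReal ^ 2 := by
  have hsubset : Ioc s t ⊆ Ioi 0 := fun x hx => hs.trans_lt hx.1
  have hm := (aemeasurable_metricDeriv hv.ac.continuousOn).mono_measure
    (Measure.restrict_mono hsubset le_rfl)
  rcases hst.eq_or_lt with rfl | hst'
  · simp
  have hi := (hv.intervalIntegrable_sq hφ hS hvD (hs.trans_lt hst')).1
  have hi' : IntegrableOn (fun r => (metricDeriv v r).toReal ^ 2) (Ioc s t) := by
    rw [intervalIntegrable_iff_integrableOn_Ioc_of_le (hs.trans hst)] at hi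
    exact hi.mono_set (Ioc_subset_Ioc_left hs)
  have hconv : ∫⁻ r in Ioc s t, metricDeriv v r ^ 2 =
      ENNReal.ofReal (∫ r in s..t, (metricDeriv v r).toReal ^ 2) := by
    rw [intervalIntegral.integral_of_le hst,
      ofReal_integral_eq_lintegral_ofReal hi' (ae_of_all _ fun r => sq_nonneg _)]
    refine lintegral_congr_ae ((ae_restrict_iff' measurableSet_Ioc).2 ?_)
    filter_upwards [hv.ae_ne_top hφ hS hvD] with r hr hrI
    exact (ofReal_toReal_sq (hr (hsubset hrI)).1).symm
  have h := (pow_le_pow_left₀ bot_le (hv.ac.ofReal_dist_le hs hst) 2).trans (sq_lintegral_le hm)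
  rw [hconv, ← ENNReal.ofReal_pow dist_nonneg, ← ENNReal.ofReal_mul (sub_nonneg.2 hst)] at h
  refine (ENNReal.ofReal_le_ofReal_iff (mul_nonneg (sub_nonneg.2 hst) ?_)).1 h
  exact intervalIntegral.integral_nonneg hst fun r _ => sq_nonneg _

/-- The energy identity: the averaged chain rule provides the inequality opposite to the energy
dissipation inequality. -/
lemma SatisfiesEDI.energy_sub_eq (hφ : IsProperLSC φ) (hS : IsEVIGradientFlow φ lam D S)
    (hv : SatisfiesEDI φ v) (hvD : ∀ t, 0 ≤ t → v t ∈ D) {T : ℝ} (hT : 0 < T) :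
    (φ (v 0)).toReal - (φ (v T)).toReal = ∫ t in 0..T,
      ((metricDeriv v t).toReal ^ 2 / 2 + (slope φ (v t)).toReal ^ 2 / 2) := by
  obtain ⟨hi1, hi2, hle⟩ := hv.intervalIntegrable_sq hφ hS hvD hT
  have hT1 : (0 : ℝ) < T + 1 := by linarith
  obtain ⟨hj1, hj2, -⟩ := hv.intervalIntegrable_sq hφ hS hvD hT1
  rw [intervalIntegral.integral_add (hi1.div_const 2) (hi2.div_const 2),
    intervalIntegral.integral_div, intervalIntegral.integral_div]
  refine le_antisymm ?_ hle
  set P : ℝ → ℝ := fun t => ∫ r in 0..t, (metricDeriv v r).toReal ^ 2 with hP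
  have hsub : ∀ t, 0 ≤ t → t ≤ T + 1 →
      IntervalIntegrable (fun r => (metricDeriv v r).toReal ^ 2) volume 0 t := fun t h0 ht =>
    hj1.mono_set (by rw [uIcc_of_le h0, uIcc_of_le hT1.le]; exact Icc_subset_Icc_right ht)
  have hPsub : ∀ s ∈ Icc 0 (T + 1), ∀ t ∈ Icc 0 (T + 1),
      P t - P s = ∫ r in s..t, (metricDeriv v r).toReal ^ 2 := fun s hs t ht =>
    intervalIntegral.integral_interval_sub_left (hsub t ht.1 ht.2) (hsub s hs.1 hs.2)
  have hPmono : MonotoneOn P (Icc 0 (T + 1)) := by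
    intro s hs t ht hst
    rw [← sub_nonneg, hPsub s hs t ht]
    exact intervalIntegral.integral_nonneg hst fun r _ => sq_nonneg _
  have hPcont : ContinuousOn P (Icc 0 (T + 1)) := by
    have := (hj1.absolutelyContinuousOnInterval_intervalIntegral left_mem_uIcc).continuousOn
    rwa [uIcc_of_le hT1.le] at this
  have hPT : Tendsto P (𝓝[>] T) (𝓝 (P T)) :=
    (hPcont T ⟨hT.le, by linarith⟩).mono_left (nhdsWithin_le_of_mem (t := Ioi T)
      (by filter_upwards [Ioo_mem_nhdsGT (show T < T + 1 by linarith)] with s hs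
          exact show s ∈ Icc 0 (T + 1) from ⟨hT.le.trans hs.1.le, hs.2.le⟩))
  have hd : ∀ s ∈ Icc 0 (T + 1), ∀ t ∈ Icc 0 (T + 1),
      dist (v s) (v t) ^ 2 ≤ |t - s| * |P t - P s| := by
    have key : ∀ s ∈ Icc 0 (T + 1), ∀ t ∈ Icc 0 (T + 1), s ≤ t →
        dist (v s) (v t) ^ 2 ≤ |t - s| * |P t - P s| := by
      intro s hs t ht hst
      rw [abs_of_nonneg (sub_nonneg.2 hst), abs_of_nonneg (sub_nonneg.2 (hPmono hs ht hst)),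
        hPsub s hs t ht]
      exact hv.sq_dist_le_integral hφ hS hvD hs.1 hst
    intro s hs t ht
    rcases le_total s t with h | h
    · exact key s hs t ht h
    · rw [dist_comm, abs_sub_comm t, abs_sub_comm (P t)]
      exact key t ht s hs h
  -- Young's inequality splits slope times distance into the two halves of the dissipation
  have hmain := sub_le_integral_add_of_ae_sub_le (f := fun t => (φ (v t)).toReal) (P := P)
    (q := fun t => (slope φ (v t)).toReal ^ 2 / 2) (κ := 1 / 2) (C := |lam| / 2) hT (by norm_num)
    (by positivity) (hv.intervalIntegrable_energy hφ hT1.le) hPmono hPT (hj2.div_const 2)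
    (fun s => by positivity)
    (fun c hc => hφ.eventually_lt_energy hv.ac.continuousOn (fun t ht => hv.mem_dom' hφ ht) le_rfl
      hc) ?_
  · rw [intervalIntegral.integral_div] at hmain
    have : P 0 = 0 := intervalIntegral.integral_same
    rw [this] at hmain
    linarith
  · filter_upwards [hv.ae_ne_top hφ hS hvD] with s hs hsI t ht
    have hs0 := hsI.1
    have hg := hS.sub_le_slope_mul_dist hφ (hvD s hs0.le) (hv.mem_dom' hφ hs0.le) (hs hs0).2
      (hv.mem_dom' hφ ht.1)
    set G := (slope φ (v s)).toReal
    have hdst := hd s (Ioo_subset_Icc_self hsI) t ht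
    have hyoung : G * dist (v s) (v t) ≤ (|t - s| * G ^ 2 + |P t - P s|) / 2 := by
      refine le_half_add_of_sq_le_mul (by positivity) (abs_nonneg _) ?_
      rw [mul_pow]
      calc G ^ 2 * dist (v s) (v t) ^ 2 ≤ G ^ 2 * (|t - s| * |P t - P s|) := by gcongr
        _ = |t - s| * G ^ 2 * |P t - P s| := by ring
    have h3 := mul_le_mul_of_nonneg_right (neg_abs_le lam) (sq_nonneg (dist (v s) (v t)))
    have h4 := mul_le_mul_of_nonneg_left hdst (abs_nonneg lam)
    linarith

/-- A slope inequality along a curve of right speed at most `r` bounds the rate of decrease. -/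
lemma neg_deriv_le_mul {f d : ℝ → ℝ} {f' t G r C : ℝ} (hG : 0 ≤ G) (hC : 0 ≤ C)
    (hf : HasDerivAt f f' t) (h : ∀ᶠ z in 𝓝[>] t, f t - f z ≤ G * d z + C * d z ^ 2)
    (hd : ∀ᶠ z in 𝓝[>] t, 0 ≤ d z ∧ d z ≤ r * (z - t)) : -f' ≤ G * r := by
  have hslope := (tendsto_slope_nhdsGT hf).neg
  have hlim : Tendsto (fun z => G * r + C * r ^ 2 * (z - t)) (𝓝[>] t)
      (𝓝 (G * r + C * r ^ 2 * (t - t))) :=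
    (Continuous.tendsto (by fun_prop) t).mono_left nhdsWithin_le_nhds
  rw [sub_self, mul_zero, add_zero] at hlim
  refine le_of_tendsto_of_tendsto hslope hlim ?_
  filter_upwards [h, hd, self_mem_nhdsWithin] with z h1 h2 hz
  have hzt : 0 < z - t := sub_pos.2 hz
  rw [slope_def_field, ← neg_div, div_le_iff₀ hzt]
  have h3 : d z ^ 2 ≤ (r * (z - t)) ^ 2 := pow_le_pow_left₀ h2.1 h2.2 2
  have h4 := mul_le_mul_of_nonneg_left h3 hC
  have h5 := mul_le_mul_of_nonneg_left h2.2 hG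
  linarith

/-- Along a curve satisfying the energy dissipation inequality the metric speed equals the slope
and the energy decreases at the rate given by the square of the slope. -/
lemma SatisfiesEDI.ae_hasDerivAt (hφ : IsProperLSC φ) (hS : IsEVIGradientFlow φ lam D S)
    (hv : SatisfiesEDI φ v) (hvD : ∀ t, 0 ≤ t → v t ∈ D) :
    ∀ᵐ t, 0 < t → slope φ (v t) ≠ ⊤ ∧ metricDeriv v t = slope φ (v t) ∧
      HasDerivAt (fun s => (φ (v s)).toReal) (-(slope φ (v t)).toReal ^ 2) t := by
  set e : ℝ → ℝ := fun t => (metricDeriv v t).toReal ^ 2 / 2 + (slope φ (v t)).toReal ^ 2 / 2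
  have hint : ∀ n : ℕ, IntervalIntegrable e volume 0 ((n : ℝ) + 1) := fun n => by
    obtain ⟨h1, h2, -⟩ := hv.intervalIntegrable_sq hφ hS hvD (T := (n : ℝ) + 1) (by positivity)
    exact (h1.div_const 2).add (h2.div_const 2)
  filter_upwards [ae_all_iff.2 fun n => (hint n).ae_hasDerivAt_integral,
    hv.ae_ne_top hφ hS hvD] with t ht htop ht0
  obtain ⟨hMtop, hGtop⟩ := htop ht0
  obtain ⟨n, hn⟩ := exists_nat_ge t
  have hn0 : (0 : ℝ) ≤ (n : ℝ) + 1 := by positivity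
  have hder := ht n (by rw [uIcc_of_le hn0]; exact ⟨ht0.le, by linarith⟩) 0 left_mem_uIcc
  have hf : HasDerivAt (fun s => (φ (v s)).toReal) (-e t) t := by
    refine (hder.const_sub (φ (v 0)).toReal).congr_of_eventuallyEq ?_
    filter_upwards [Ioi_mem_nhds ht0] with s hs
    have := hv.energy_sub_eq hφ hS hvD hs
    simp only [e]
    linarith
  have hG0 : 0 ≤ (slope φ (v t)).toReal := ENNReal.toReal_nonneg
  have hle : e t ≤ (slope φ (v t)).toReal * (metricDeriv v t).toReal := by
    refine le_of_forall_pos_le_add fun ε hε => ?_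
    have hη : 0 < ε / ((slope φ (v t)).toReal + 1) := by positivity
    have hlt : metricDeriv v t < ENNReal.ofReal
        ((metricDeriv v t).toReal + ε / ((slope φ (v t)).toReal + 1)) := by
      rw [ENNReal.lt_ofReal_iff_toReal_lt hMtop]
      linarith
    have h := neg_deriv_le_mul (d := fun z => dist (v t) (v z)) (C := |lam| / 2) hG0
      (by positivity) hf ?_ ?_ (r := (metricDeriv v t).toReal + ε / ((slope φ (v t)).toReal + 1))
    · have e1 : ε / ((slope φ (v t)).toReal + 1) * ((slope φ (v t)).toReal + 1) = ε := by
        field_simp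
      linarith
    · filter_upwards [self_mem_nhdsWithin] with z hz
      have hg := hS.sub_le_slope_mul_dist hφ (hvD t ht0.le) (hv.mem_dom' hφ ht0.le) hGtop
        (hv.mem_dom' hφ (ht0.le.trans (le_of_lt hz)))
      have := mul_le_mul_of_nonneg_right (neg_abs_le lam) (sq_nonneg (dist (v t) (v z)))
      linarith
    · filter_upwards [eventually_dist_le_of_metricDeriv_lt hlt] with z hz
      rw [dist_comm]
      exact ⟨dist_nonneg, hz⟩
  have heq : (metricDeriv v t).toReal = (slope φ (v t)).toReal := by
    have hsq : ((metricDeriv v t).toReal - (slope φ (v t)).toReal) ^ 2 ≤ 0 := by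
      simp only [e] at hle
      linarith
    have := pow_eq_zero_iff (two_ne_zero) |>.1 (le_antisymm hsq (sq_nonneg _))
    linarith
  refine ⟨hGtop, (ENNReal.toReal_eq_toReal_iff' hMtop hGtop).1 heq, hf.congr_deriv ?_⟩
  simp only [e, heq]
  ring

/-- A curve satisfying the energy dissipation inequality is tangent, at almost every time, to the
flow trajectory issued from its current position. -/
lemma SatisfiesEDI.ae_eventually_dist_le (hφ : IsProperLSC φ) (hS : IsEVIGradientFlow φ lam D S)
    (hv : SatisfiesEDI φ v) (hvD : ∀ t, 0 ≤ t → v t ∈ D) :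
    ∀ᵐ t, 0 < t → ∀ ε > 0, ∀ᶠ h in 𝓝[>] 0, dist (S h (v t)) (v (t + h)) ≤ ε * h := by
  filter_upwards [hv.ae_hasDerivAt hφ hS hvD] with t ht ht0 ε hε
  obtain ⟨hGtop, hM, hf⟩ := ht ht0
  have hx := hvD t ht0.le
  have h0 := hS.zero _ hx
  have hadd := tendsto_add_nhdsGT t
  refine (hS.evi _ hx).eventually_dist_le_mul hφ (hS.continuousOn_orbit hx)
    (by rw [h0]; exact hv.mem_dom' hφ ht0.le) (by rwa [h0]) (w := fun h => v (t + h))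
    (fun h hh => hv.mem_dom' hφ (by linarith)) ?_ ?_ hε
  · intro η hη
    have hlt : metricDeriv v t < ENNReal.ofReal ((slope φ (v t)).toReal + η) := by
      rw [hM, ENNReal.lt_ofReal_iff_toReal_lt hGtop]
      linarith
    filter_upwards [hadd.eventually (eventually_dist_le_of_metricDeriv_lt hlt)] with h hh
    rw [h0, dist_comm]
    simpa using hh
  · intro η hη
    have hslope := tendsto_slope_nhdsGT hf
    filter_upwards [hadd.eventually (hslope.eventually (gt_mem_nhds
      (show -(slope φ (v t)).toReal ^ 2 < -(slope φ (v t)).toReal ^ 2 + η by linarith))),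
      self_mem_nhdsWithin] with h hh hpos
    have hpos' : 0 < t + h - t := by simpa using hpos
    rw [slope_def_field, div_lt_iff₀ hpos', add_sub_cancel_left] at hh
    rw [h0]
    exact hh.le

/-- An absolutely continuous function vanishing at `0` whose derivative is at most a multiple of
its value is nonpositive. -/
lemma nonpos_of_ae_deriv_le {δ : ℝ → ℝ} {K T : ℝ} (hT : 0 ≤ T)
    (hδ : AbsolutelyContinuousOnInterval δ 0 T) (h0 : δ 0 = 0)
    (h : ∀ᵐ t, t ∈ Ioo 0 T → deriv δ t ≤ K * δ t) : δ T ≤ 0 := by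
  have hexp : AbsolutelyContinuousOnInterval (fun t => Real.exp (-K * t)) 0 T :=
    (ContDiff.contDiffOn (by fun_prop)).absolutelyContinuousOnInterval
  have hac := hexp.fun_mul hδ
  have hint := hac.integral_deriv_eq_sub
  have hle : (∫ t in 0..T, deriv (fun t => Real.exp (-K * t) * δ t) t) ≤ ∫ t in 0..T, (0 : ℝ) := by
    refine integral_le_integral_of_ae_Ioo hT hac.intervalIntegrable_deriv
      intervalIntegrable_const ?_
    filter_upwards [hδ.ae_differentiableAt, h] with t hd hle ht
    have hdt := (hd (by rw [uIcc_of_le hT]; exact Ioo_subset_Icc_self ht)).hasDerivAt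
    have he : HasDerivAt (fun t => Real.exp (-K * t)) (Real.exp (-K * t) * -K) t := by
      simpa using ((hasDerivAt_id t).const_mul (-K)).exp
    have hprod : HasDerivAt (fun t => Real.exp (-K * t) * δ t)
        (Real.exp (-K * t) * -K * δ t + Real.exp (-K * t) * deriv δ t) t := he.mul hdt
    rw [hprod.deriv]
    have := mul_le_mul_of_nonneg_left (hle ht) (Real.exp_pos (-K * t)).le
    linarith
  rw [hint, intervalIntegral.integral_zero, h0, mul_zero, sub_zero] at hle
  exact nonpos_of_mul_nonpos_right hle (Real.exp_pos _)

/-- A curve satisfying the energy dissipation inequality is the flow trajectory `u` issued from its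
starting point. The distance `δ` between the two satisfies
`δ (t + h) ≤ dist (v (t + h)) (S h (v t)) + dist (S h (v t)) (S h (u t))`, where almost everywhere
the first term is `o(h)` by tangency and the second is at most `exp (-λ h) * δ t` by contraction. -/
lemma SatisfiesEDI.eq_flow (hφ : IsProperLSC φ) (hS : IsEVIGradientFlow φ lam D S)
    (hv : SatisfiesEDI φ v) (hvD : ∀ t, 0 ≤ t → v t ∈ D) {T : ℝ} (hT : 0 ≤ T) :
    v T = S T (v 0) := by
  have hx := hvD 0 le_rfl
  have h0 := hS.zero _ hx
  set u : ℝ → X := fun t => S t (v 0) with hu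
  have huc : ContinuousOn u (Ici 0) := hS.continuousOn_orbit hx
  have huac : LocACOn 2 (Ici 0) u :=
    (hS.evi _ hx).locACOn hφ huc (by change S 0 (v 0) ∈ Dom φ; rw [h0]; exact hv.mem_dom)
  have huD : ∀ t, 0 ≤ t → u t ∈ D := fun t ht => hS.mapsTo t ht hx
  have hδ : AbsolutelyContinuousOnInterval (fun t => dist (v t) (u t)) 0 T := by
    obtain ⟨P, hP, hPd⟩ := (hv.ac.acOn le_rfl hT).exists_absolutelyContinuous hT
    obtain ⟨Q, hQ, hQd⟩ := (huac.acOn le_rfl hT).exists_absolutelyContinuous hT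
    rw [absolutelyContinuousOnInterval_iff] at hP hQ ⊢
    intro ε hε
    obtain ⟨a, ha, hPa⟩ := hP (ε / 2) (half_pos hε)
    obtain ⟨b, hb, hQb⟩ := hQ (ε / 2) (half_pos hε)
    refine ⟨min a b, lt_min ha hb, fun E hE hEδ => ?_⟩
    have h1 := hPa E hE (hEδ.trans_le (min_le_left _ _))
    have h2 := hQb E hE (hEδ.trans_le (min_le_right _ _))
    have h3 : ∑ i ∈ Finset.range E.1, dist (dist (v (E.2 i).1) (u (E.2 i).1))
        (dist (v (E.2 i).2) (u (E.2 i).2)) ≤ ∑ i ∈ Finset.range E.1,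
        (dist (P (E.2 i).1) (P (E.2 i).2) + dist (Q (E.2 i).1) (Q (E.2 i).2)) := by
      refine Finset.sum_le_sum fun i hi => (dist_dist_dist_le _ _ _ _).trans ?_
      obtain ⟨m1, m2⟩ := hE.1 i hi
      rw [uIcc_of_le hT] at m1 m2
      exact add_le_add (hPd _ m1 _ m2) (hQd _ m1 _ m2)
    rw [Finset.sum_add_distrib] at h3
    linarith
  have hle := nonpos_of_ae_deriv_le (K := -lam) hT hδ (by simp [hu, h0]) ?_
  · exact dist_eq_zero.1 (le_antisymm hle dist_nonneg)
  filter_upwards [hδ.ae_differentiableAt, hv.ae_eventually_dist_le hφ hS hvD] with t hd htan htI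
  have ht0 := htI.1
  have hslope := tendsto_slope_nhdsGT
    (hd (by rw [uIcc_of_le hT]; exact Ioo_subset_Icc_self htI)).hasDerivAt
  refine le_of_forall_pos_le_add fun ε hε => ?_
  have hexp : Tendsto (fun z => _root_.slope (fun z => Real.exp (-lam * (z - t))) t z *
      dist (v t) (u t) + ε) (𝓝[>] t) (𝓝 (-lam * dist (v t) (u t) + ε)) := by
    have he : HasDerivAt (fun z => Real.exp (-lam * (z - t))) (-lam) t := by
      simpa using (((hasDerivAt_id t).sub_const t).const_mul (-lam)).exp
    exact ((tendsto_slope_nhdsGT he).mul_const _).add_const ε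
  refine le_of_tendsto_of_tendsto hslope hexp ?_
  filter_upwards [(tendsto_sub_nhdsGT t).eventually (htan ht0 ε hε), self_mem_nhdsWithin]
    with z hz hzt
  have hzt' : 0 < z - t := sub_pos.2 hzt
  rw [add_sub_cancel] at hz
  have hvt := hvD t ht0.le
  have hut := huD t ht0.le
  have hcontr := (hS.evi _ hvt).dist_le_exp_mul_dist hφ (hS.evi _ hut)
    (hS.continuousOn_orbit hvt) (hS.continuousOn_orbit hut) hzt'.le
  rw [hS.zero _ hvt, hS.zero _ hut] at hcontr
  have hsemi : u z = S (z - t) (u t) := by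
    have := hS.semigroup _ hx t (z - t) ht0.le hzt'.le
    rwa [add_sub_cancel] at this
  have htri := dist_triangle_left (v z) (u z) (S (z - t) (v t))
  rw [← hsemi] at hcontr
  have e : (_root_.slope (fun z => Real.exp (-lam * (z - t))) t z * dist (v t) (u t) + ε) *
      (z - t) = (Real.exp (-lam * (z - t)) - 1) * dist (v t) (u t) + ε * (z - t) := by
    rw [slope_def_field]
    field_simp
    simp
    ring
  rw [slope_def_field (fun t => dist (v t) (u t)), div_le_iff₀ hzt', e]
  linarith

/-- The fundamental theorem of calculus for the absolutely continuous energy. -/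
lemma IsCurveOfMaximalSlope.satisfiesEDI (hφ : IsProperLSC φ) (hv : IsCurveOfMaximalSlope φ v) :
    SatisfiesEDI φ v where
  ac := hv.ac
  mem_dom := hv.mem_dom 0 le_rfl
  edi t ht := by
    have hac := hv.energy_ac t ht
    have hdle := (ae_restrict_iff' measurableSet_Ioi).1 hv.deriv_le
    have hpt : ∀ᵐ s, s ∈ Ioc 0 t → dissipation φ v s ≤
          ENNReal.ofReal (-deriv (fun s => (φ (v s)).toReal) s) ∧
        0 ≤ -deriv (fun s => (φ (v s)).toReal) s := by
      filter_upwards [hdle] with s hs hsI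
      have h1 := EReal.le_neg_of_le_neg (hs hsI.1)
      rw [← EReal.coe_neg] at h1
      have h2 : 0 ≤ -deriv (fun s => (φ (v s)).toReal) s :=
        EReal.coe_nonneg.1 ((EReal.coe_ennreal_nonneg _).trans h1)
      refine ⟨?_, h2⟩
      rw [← EReal.coe_ennreal_le_coe_ennreal_iff, EReal.coe_ennreal_ofReal, max_eq_left h2]
      exact h1
    have hle : ∫⁻ r in Ioc 0 t, dissipation φ v r ≤
        ENNReal.ofReal ((φ (v 0)).toReal - (φ (v t)).toReal) := by
      have hint : IntegrableOn (fun s => -deriv (fun s => (φ (v s)).toReal) s) (Ioc 0 t) := by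
        rw [← intervalIntegrable_iff_integrableOn_Ioc_of_le ht.le]
        exact hac.intervalIntegrable_deriv.neg
      have hval : (φ (v 0)).toReal - (φ (v t)).toReal =
          ∫ s in Ioc 0 t, -deriv (fun s => (φ (v s)).toReal) s := by
        rw [← intervalIntegral.integral_of_le ht.le, intervalIntegral.integral_neg,
          hac.integral_deriv_eq_sub]
        ring
      rw [hval, ofReal_integral_eq_lintegral_ofReal hint
        ((ae_restrict_iff' measurableSet_Ioc).2 (hpt.mono fun s hs hsI => (hs hsI).2))]
      exact lintegral_mono_ae ((ae_restrict_iff' measurableSet_Ioc).2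
        (hpt.mono fun s hs hsI => (hs hsI).1))
    have h0 : 0 ≤ (φ (v 0)).toReal - (φ (v t)).toReal := by
      have := integral_le_integral_of_ae_Ioo ht.le (f := deriv fun s => (φ (v s)).toReal)
        (g := fun _ => 0) hac.intervalIntegrable_deriv intervalIntegrable_const
        (hpt.mono fun s hs hsI => by linarith [(hs (Ioo_subset_Ioc_self hsI)).2])
      rw [hac.integral_deriv_eq_sub, intervalIntegral.integral_zero] at this
      linarith
    have h1 := EReal.coe_ennreal_le_coe_ennreal_iff.2 hle
    rw [EReal.coe_ennreal_ofReal, max_eq_left h0] at h1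
    refine (add_le_add_left h1 _).trans ?_
    rw [← hφ.coe_toReal (hv.mem_dom t ht.le), ← hφ.coe_toReal (hv.mem_dom 0 le_rfl),
      ← EReal.coe_add, EReal.toReal_coe, EReal.toReal_coe]
    exact EReal.coe_le_coe_iff.2 (by linarith)

lemma IsEVISolution.congr (hu : IsEVISolution φ lam u) (h : ∀ t, 0 < t → v t = u t) :
    IsEVISolution φ lam v where
  continuousOn := hu.continuousOn.congr fun t ht => h t ht
  mem_dom t ht := by
    rw [h t ht]
    exact hu.mem_dom t ht
  evi t ht w hw := by
    have hD : upperRightDini (fun s => dist (v s) w ^ 2) t =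
        upperRightDini (fun s => dist (u s) w ^ 2) t := by
      refine limsup_congr ?_
      filter_upwards [self_mem_nhdsWithin] with s hs
      rw [h t ht, h (t + s) (by have := mem_Ioi.1 hs; linarith)]
    rw [hD, h t ht]
    exact hu.evi t ht w hw

end MetricFlow

theorem theorem4p2 {X : Type*} [MetricSpace X] (φ : X → EReal) (hφ : MetricFlow.IsProperLSC φ)
    (lam : ℝ) (D : Set X) (S : ℝ → X → X) (hS : MetricFlow.IsEVIGradientFlow φ lam D S) :
    (∀ v : ℝ → X, (∀ t, 0 ≤ t → v t ∈ D) → MetricFlow.SatisfiesEDI φ v →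
      ∀ t, 0 ≤ t → v t = S t (v 0)) ∧
    (∀ v : ℝ → X, (∀ t, 0 ≤ t → v t ∈ D) → v 0 ∈ MetricFlow.Dom φ →
      (MetricFlow.IsCurveOfMaximalSlope φ v ↔
        MetricFlow.IsEVISolution φ lam v ∧ ContinuousOn v (Set.Ici 0)) ∧
      (MetricFlow.SatisfiesEDI φ v ↔
        MetricFlow.IsEVISolution φ lam v ∧ ContinuousOn v (Set.Ici 0))) ∧
    (∀ v w : ℝ → X, (∀ t, 0 ≤ t → v t ∈ D) → (∀ t, 0 ≤ t → w t ∈ D) →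
      MetricFlow.SatisfiesEDI φ v → MetricFlow.SatisfiesEDI φ w → v 0 = w 0 →
      ∀ t, 0 ≤ t → v t = w t) := by
  refine ⟨fun v hvD hv t ht => hv.eq_flow hφ hS hvD ht, fun v hvD h0 => ?_,
    fun v w hvD hwD hv hw h t ht => ?_⟩
  · have hEDI : MetricFlow.SatisfiesEDI φ v →
        MetricFlow.IsEVISolution φ lam v ∧ ContinuousOn v (Set.Ici 0) := fun hv =>
      ⟨(hS.evi _ (hvD 0 le_rfl)).congr fun t ht => hv.eq_flow hφ hS hvD ht.le, hv.ac.continuousOn⟩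
    exact ⟨⟨fun hv => hEDI (hv.satisfiesEDI hφ), fun hv => hv.1.isCurveOfMaximalSlope hφ hv.2 h0⟩,
      hEDI, fun hv => (hv.1.isCurveOfMaximalSlope hφ hv.2 h0).satisfiesEDI hφ⟩
  · rw [hv.eq_flow hφ hS hvD ht, hw.eq_flow hφ hS hwD ht, h]
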